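/- Let $(M,g)$ be a smooth (Hausdorff) Lorentzian manifold of dimension $d\ge 2$ and signature $(-,+,\dots,+)$, and let $V$ be a smooth Killing field which is null and non-zero everywhere. Put $\omega_{ab}=\nabla_bV_a=-\omega_{ba}$. Let $\gamma:J\to M$ be an integral curve of $V$ on an open interval $J$. Then $\gamma$ is an affinely parametrized null geodesic, and the following holds. 1. Let $Y$ be the deviation vector $\partial_\lambda\Gamma|_{\lambda=0}$ of a smooth one-parameter family $\Gamma(\lambda,t)$ of affinely parametrized causal geodesics $\Gamma(\lambda,\cdot)$, defined for $(\lambda,t)$ in an open neighbourhood of $\{0\}\times J$, with $\Gamma(0,\cdot)=\gamma$. Then $Y$ is a Jacobi field along $\gamma$, and $V\cdot Y$ is constant along $\gamma$. 2. For every Jacobi field $Y$ along $\gamma$ (that is, $\nabla_V\nabla_VY=R(V,Y)V$) the quantity $$(\nabla_VY_a)(\nabla_VY^a)+\omega_{ac}\,\omega_b{}^c\,Y^aY^b=C'$$ is constant along $\gamma$. 3. Let $Y$ be a Jacobi field along $\gamma$ such that $V\cdot Y$ is constant. Then: (a) there is a constant $C''$ with $0\le\omega_{ac}\,\omega_b{}^c\,Y^aY^b\le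 C''$ along $\gamma$; (b) for every parallelly transported null frame $e_0=V,e_1,e_2,\dots,e_{d-1}$ along $\gamma$ ($e_1$ null, $e_0\cdot e_1=-1$, the $e_i$ with $i\ge2$ orthonormal and orthogonal to $e_0,e_1$), the functions $\sum_{j\ge2}\omega_{ij}Y^j$, $i\ge 2$, are bounded along $\gamma$, where $\omega_{ij}=\omega_{ab}e_i^ae_j^b$ and $Y^j=e_j\cdot Y$; (c) if $Z$ is a Killing field commuting with $V$ and $\gamma$ meets the ergosurface $\mathcal S=\{Z\cdot V=0\}$, then $\gamma$ stays on $\mathcal S$ and $n\cdot Y$ is bounded along $\gamma$, where $n_a=\nabla_a(Z\cdot V)$; (d) if the rotation is non-degenerate at some point of $\gamma$, i.e. $\omega$ induces a non-degenerate two-form on $V^\perp/\langle V\rangle$ there (equivalently, the matrix $(\omega_{ij})_{i,j\ge2}$ is invertible), then there is a constant $b$ such that all components of $Y-b\,t\,V$ in parallelly transported frames are bounded along $\gamma$. 4. If the rotation is non-degenerate at some point of $\gamma$, then $\gamma$ is stably trapped: for every family $\Gamma$ as in 1 there is a change of affine parameter $t\mapsto a(\lambda)t$ along the geodesics of the family,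 with $a$ smooth and positive and $a(0)=1$, such that all components, in parallelly transported frames, of the deviation vector of the reparametrized family $\Gamma(\lambda,a(\lambda)t)$ are bounded along $\gamma$. Moreover, through every point $p$ at which the rotation is non-degenerate there passes an inextendible null geodesic with tangent $V$ which is stably trapped. In particular, if $d=6$ and the rotation is non-degenerate everywhere, a stably trapped null geodesic passes through every point of the spacetime. -/

import Mathlib

open Set Filter Topology
open scoped Manifold ContDiff

noncomputable section

namespace NullKilling

/-! ### Lorentzian metrics -/

section Manifolds

variable {E : Type*} [NormedAddCommGroup E] [NormedSpace ℝ E]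
  {M : Type*} [TopologicalSpace M] [ChartedSpace E M]

/-- A smooth Lorentzian metric on `M`, of signature `(-, +, …, +)`: at every point there is a
timelike vector whose orthogonal complement is positive definite. -/
structure LorentzMetric (E : Type*) [NormedAddCommGroup E] [NormedSpace ℝ E]
    (M : Type*) [TopologicalSpace M] [ChartedSpace E M] [IsManifold 𝓘(ℝ, E) ∞ M] where
  inner : ∀ p : M, TangentSpace 𝓘(ℝ, E) p →L[ℝ] TangentSpace 𝓘(ℝ, E) p →L[ℝ] ℝ
  symm : ∀ (p : M) (u w : TangentSpace 𝓘(ℝ, E) p), inner p u w = inner p w u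
  lorentzian : ∀ p : M, ∃ τ : TangentSpace 𝓘(ℝ, E) p, inner p τ τ < 0 ∧
    ∀ u : TangentSpace 𝓘(ℝ, E) p, inner p τ u = 0 → u ≠ 0 → 0 < inner p u u
  contMDiff : ContMDiff 𝓘(ℝ, E) (𝓘(ℝ, E).prod 𝓘(ℝ, E →L[ℝ] E →L[ℝ] ℝ)) ∞
    (fun p ↦ Bundle.TotalSpace.mk' (E →L[ℝ] E →L[ℝ] ℝ)
      (E := fun p : M ↦ TangentSpace 𝓘(ℝ, E) p →L[ℝ] TangentSpace 𝓘(ℝ, E) p →L[ℝ] ℝ)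
      p (inner p))

/-! ### Coordinate formulas for the Levi-Civita connection and the curvature

In the next two definitions `G` is a metric written in coordinates: `G x u w = g_{ij}(x) u^i w^j`. -/

/-- The Christoffel symbols of the second kind, `Γ^k_{ij}(x) u^i v^j`: the index of
`½ (∂_i g_{jk} + ∂_j g_{ik} - ∂_k g_{ij}) u^i v^j` is raised with the inverse metric. -/
def christoffel (G : E → E →L[ℝ] E →L[ℝ] ℝ) (x u v : E) : E :=
  (G x).inverse ((1 / 2 : ℝ) •
    (fderiv ℝ G x u v + fderiv ℝ G x v u - ((fderiv ℝ G x).flip u).flip v))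

/-- The curvature `R(u, v) w = ∇_u ∇_v w - ∇_v ∇_u w` of constant coordinate fields. -/
def curvature (G : E → E →L[ℝ] E →L[ℝ] ℝ) (x u v w : E) : E :=
  fderiv ℝ (fun y ↦ christoffel G y v w) x u - fderiv ℝ (fun y ↦ christoffel G y u w) x v
    + christoffel G x u (christoffel G x v w) - christoffel G x v (christoffel G x u w)

/-- The coordinate vector, in the chart `φ`, of a tangent vector at `q`. -/
def coordVec (φ : OpenPartialHomeomorph M E) (q : M) : TangentSpace 𝓘(ℝ, E) q →L[ℝ] E :=
  mfderiv 𝓘(ℝ, E) 𝓘(ℝ, E) φ q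

variable [IsManifold 𝓘(ℝ, E) ∞ M]

/-- The metric in the coordinates of the chart `φ`: its pullback by `φ⁻¹`. -/
def LorentzMetric.inChart (g : LorentzMetric E M) (φ : OpenPartialHomeomorph M E) (x : E) :
    E →L[ℝ] E →L[ℝ] ℝ :=
  letI D : E →L[ℝ] E := mfderiv 𝓘(ℝ, E) 𝓘(ℝ, E) φ.symm x
  letI B : E →L[ℝ] E →L[ℝ] ℝ := g.inner (φ.symm x)
  B.bilinearComp D D

/-- The Levi-Civita covariant derivative `∇_u X` of a vector field `X` in the direction
`u ∈ T_p M`: in the preferred chart at `p`, `(∇_u X)^k = u^i ∂_i X^k + Γ^k_{ij} u^i X^j`. -/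
def nabla (g : LorentzMetric E M) (X : ∀ p : M, TangentSpace 𝓘(ℝ, E) p) (p : M)
    (u : TangentSpace 𝓘(ℝ, E) p) : TangentSpace 𝓘(ℝ, E) p :=
  letI φ := chartAt E p
  (coordVec φ p).inverse
    (fderiv ℝ (fun x : E ↦ coordVec φ (φ.symm x) (X (φ.symm x))) (φ p) (coordVec φ p u)
      + christoffel (g.inChart φ) (φ p) (coordVec φ p u) (coordVec φ p (X p)))

/-- The Riemann tensor `R(u, v) w` at `p`, with
`R(X, Y) Z = ∇_X ∇_Y Z - ∇_Y ∇_X Z - ∇_{[X, Y]} Z`. -/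
def riemann (g : LorentzMetric E M) (p : M) (u v w : TangentSpace 𝓘(ℝ, E) p) :
    TangentSpace 𝓘(ℝ, E) p :=
  letI φ := chartAt E p
  (coordVec φ p).inverse
    (curvature (g.inChart φ) (φ p) (coordVec φ p u) (coordVec φ p v) (coordVec φ p w))

/-! ### Vector fields along curves -/

/-- The velocity `γ'(t)`. -/
def velocity (γ : ℝ → M) (t : ℝ) : TangentSpace 𝓘(ℝ, E) (γ t) :=
  mfderiv 𝓘(ℝ, ℝ) 𝓘(ℝ, E) γ t (1 : ℝ)

/-- The field `Y` along the curve `γ` is differentiable at `t` and its covariant derivative along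
`γ` at `t` is `Y'`: in the preferred chart at `γ t`,
`(Y')^k = dY^k/dt + Γ^k_{ij} (dx^i/dt) Y^j`. -/
def HasCovDerivAlong (g : LorentzMetric E M) (γ : ℝ → M)
    (Y : ∀ t, TangentSpace 𝓘(ℝ, E) (γ t)) (t : ℝ) (Y' : TangentSpace 𝓘(ℝ, E) (γ t)) : Prop :=
  letI φ := chartAt E (γ t)
  MDifferentiableAt 𝓘(ℝ, ℝ) 𝓘(ℝ, E) γ t ∧
  ∃ y' : E, HasDerivAt (fun s ↦ coordVec φ (γ s) (Y s)) y' t ∧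
    coordVec φ (γ t) Y' =
      y' + christoffel (g.inChart φ) (φ (γ t)) (coordVec φ (γ t) (velocity γ t))
        (coordVec φ (γ t) (Y t))

/-- `Y` is parallelly transported along `γ` on `J`. -/
def IsParallelOn (g : LorentzMetric E M) (γ : ℝ → M) (J : Set ℝ)
    (Y : ∀ t, TangentSpace 𝓘(ℝ, E) (γ t)) : Prop :=
  ∀ t ∈ J, HasCovDerivAlong g γ Y t 0

/-- `γ` is an affinely parametrized geodesic on `J`. -/
def IsGeodesicOn (g : LorentzMetric E M) (γ : ℝ → M) (J : Set ℝ) : Prop :=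
  IsParallelOn g γ J (velocity γ)

/-- `γ` is an affinely parametrized null geodesic on `J`. -/
def IsNullGeodesicOn (g : LorentzMetric E M) (γ : ℝ → M) (J : Set ℝ) : Prop :=
  IsGeodesicOn g γ J ∧ ∀ t ∈ J,
    velocity (E := E) γ t ≠ 0 ∧ g.inner (γ t) (velocity γ t) (velocity γ t) = 0

/-- The geodesic `γ` on the open interval `J` cannot be extended to a larger open interval. -/
def IsInextendibleGeodesic (g : LorentzMetric E M) (γ : ℝ → M) (J : Set ℝ) : Prop :=
  IsGeodesicOn g γ J ∧ ∀ (γ₁ : ℝ → M) (J₁ : Set ℝ), IsOpen J₁ → J₁.OrdConnected → J ⊆ J₁ →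
    IsGeodesicOn g γ₁ J₁ → EqOn γ₁ γ J → J₁ = J

/-- `Y` is a Jacobi field along `γ` on `J`, with covariant derivative `Y'`: it solves the geodesic
deviation equation `∇_{γ'} ∇_{γ'} Y = R(γ', Y) γ'`. -/
def IsJacobiFieldOn (g : LorentzMetric E M) (γ : ℝ → M) (J : Set ℝ)
    (Y Y' : ∀ t, TangentSpace 𝓘(ℝ, E) (γ t)) : Prop :=
  ∀ t ∈ J, HasCovDerivAlong g γ Y t (Y' t) ∧
    HasCovDerivAlong g γ Y' t (riemann g (γ t) (velocity γ t) (Y t) (velocity γ t))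

/-- All components of `Y` in parallelly transported frames along `γ` are bounded on `J`. As the
metric is non-degenerate, these are the scalar products of `Y` with parallel fields. -/
def IsBoundedAlong (g : LorentzMetric E M) (γ : ℝ → M) (J : Set ℝ)
    (Y : ∀ t, TangentSpace 𝓘(ℝ, E) (γ t)) : Prop :=
  ∀ P : ∀ t, TangentSpace 𝓘(ℝ, E) (γ t), IsParallelOn g γ J P →
    ∃ C : ℝ, ∀ t ∈ J, |g.inner (γ t) (Y t) (P t)| ≤ C

/-! ### One-parameter families of causal geodesics and stable trapping -/

/-- `Γ` is a smooth one-parameter family `l ↦ Γ l` of affinely parametrized causal geodesics which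
contains `γ` (on `J`) as the member `l = 0`. It is defined on an open neighbourhood `U` of
`{0} × J`; the values of `Γ` outside `U` are irrelevant. -/
def IsCausalGeodesicFamily (g : LorentzMetric E M) (γ : ℝ → M) (J : Set ℝ)
    (Γ : ℝ → ℝ → M) : Prop :=
  (∀ t ∈ J, Γ 0 t = γ t) ∧
  ∃ U : Set (ℝ × ℝ), IsOpen U ∧ (∀ t ∈ J, ((0 : ℝ), t) ∈ U) ∧
    ContMDiffOn 𝓘(ℝ, ℝ × ℝ) 𝓘(ℝ, E) ∞ (fun q : ℝ × ℝ ↦ Γ q.1 q.2) U ∧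
    ∀ q ∈ U, HasCovDerivAlong g (Γ q.1) (velocity (Γ q.1)) q.2 0 ∧
      g.inner (Γ q.1 q.2) (velocity (Γ q.1) q.2) (velocity (Γ q.1) q.2) ≤ 0

/-- The deviation vector `∂Γ/∂l` at `l = 0`, a field along `γ` (for `t` with `Γ 0 t = γ t`). -/
def deviation (γ : ℝ → M) (Γ : ℝ → ℝ → M) (t : ℝ) : TangentSpace 𝓘(ℝ, E) (γ t) :=
  mfderiv 𝓘(ℝ, ℝ) 𝓘(ℝ, E) (fun l ↦ Γ l t) 0 (1 : ℝ)

/-- The geodesic `γ` on `J` is stably trapped: for every one-parameter family of causal geodesics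
containing `γ`, there is a change of affine parameter `t ↦ a(l) t` along the geodesics of the
family, trivial for `γ` itself, after which all components of the deviation vector in parallelly
transported frames are bounded along `γ`. -/
def IsStablyTrapped (g : LorentzMetric E M) (γ : ℝ → M) (J : Set ℝ) : Prop :=
  ∀ Γ : ℝ → ℝ → M, IsCausalGeodesicFamily g γ J Γ →
    ∃ a : ℝ → ℝ, ContDiff ℝ ∞ a ∧ a 0 = 1 ∧ (∀ l, 0 < a l) ∧
      IsBoundedAlong g γ J (deviation γ fun l t ↦ Γ l (a l * t))

/-! ### Killing fields and rotation -/

/-- `V` is a (smooth) Killing field: `∇_a V_b + ∇_b V_a = 0`. -/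
structure IsKilling (g : LorentzMetric E M) (V : ∀ p : M, TangentSpace 𝓘(ℝ, E) p) : Prop where
  contMDiff : ContMDiff 𝓘(ℝ, E) 𝓘(ℝ, E).tangent ∞
    (fun p ↦ (⟨p, V p⟩ : TangentBundle 𝓘(ℝ, E) M))
  killing : ∀ (p : M) (u w : TangentSpace 𝓘(ℝ, E) p),
    g.inner p (nabla g V p u) w + g.inner p u (nabla g V p w) = 0

/-- `V` is null (in particular nonzero) everywhere. -/
def IsGloballyNull (g : LorentzMetric E M) (V : ∀ p : M, TangentSpace 𝓘(ℝ, E) p) : Prop :=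
  ∀ p : M, V p ≠ 0 ∧ g.inner p (V p) (V p) = 0

/-- The two-form `ω_{ab} u^a w^b`, where `ω_{ab} = ∇_b V_a`. -/
def rotation (g : LorentzMetric E M) (V : ∀ p : M, TangentSpace 𝓘(ℝ, E) p) (p : M)
    (u w : TangentSpace 𝓘(ℝ, E) p) : ℝ :=
  g.inner p u (nabla g V p w)

/-- The quadratic form `ω_{ac} ω_b{}^c u^a u^b`; as `ω` is antisymmetric (for Killing `V`), it is
the norm squared of the vector `ω^c{}_b u^b = (∇_u V)^c`. -/
def rotationSq (g : LorentzMetric E M) (V : ∀ p : M, TangentSpace 𝓘(ℝ, E) p) (p : M)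
    (u : TangentSpace 𝓘(ℝ, E) p) : ℝ :=
  g.inner p (nabla g V p u) (nabla g V p u)

/-- The rotation (matrix `ω_{ij}`) of the congruence with null tangent `V` is non-degenerate at `p`:
the two-form induced by `ω` on `V^⊥ / ⟨V⟩` is non-degenerate. -/
def HasNondegenerateRotation (g : LorentzMetric E M) (V : ∀ p : M, TangentSpace 𝓘(ℝ, E) p)
    (p : M) : Prop :=
  ∀ u : TangentSpace 𝓘(ℝ, E) p, g.inner p (V p) u = 0 →
    (∀ w : TangentSpace 𝓘(ℝ, E) p, g.inner p (V p) w = 0 → rotation g V p w u = 0) →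
    ∃ c : ℝ, u = c • V p

/-- `(V, k, e_i)` is a parallelly transported null frame along the integral curve `γ` of `V` on `J`:
`k` is null with `V · k = -1`, the `e_i` are orthonormal and orthogonal to `V` and `k`, and `k` and
the `e_i` are parallel (so is `V`, the tangent vector of a geodesic). -/
structure IsParallelNullFrame (g : LorentzMetric E M) (V : ∀ p : M, TangentSpace 𝓘(ℝ, E) p)
    (γ : ℝ → M) (J : Set ℝ) {n : ℕ} (k : ∀ t, TangentSpace 𝓘(ℝ, E) (γ t))
    (e : Fin n → ∀ t, TangentSpace 𝓘(ℝ, E) (γ t)) : Prop where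
  parallel_k : IsParallelOn g γ J k
  parallel_e : ∀ i, IsParallelOn g γ J (e i)
  null_k : ∀ t ∈ J, g.inner (γ t) (k t) (k t) = 0
  inner_V_k : ∀ t ∈ J, g.inner (γ t) (V (γ t)) (k t) = -1
  inner_V_e : ∀ t ∈ J, ∀ i, g.inner (γ t) (V (γ t)) (e i t) = 0
  inner_k_e : ∀ t ∈ J, ∀ i, g.inner (γ t) (k t) (e i t) = 0
  inner_e_e : ∀ t ∈ J, ∀ i j, g.inner (γ t) (e i t) (e j t) = if i = j then 1 else 0

end Manifolds

end NullKilling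

end

set_option maxSynthPendingDepth 3
set_option linter.unusedSectionVars false

/-! Let A be the endomorphism u ↦ ∇_u V of the tangent space. The Killing equation says that A is
skew; together with V·V = 0 this gives A V = 0, hence im A ⊂ V^⊥. The Ricci and Bianchi identities
and skewness give ∇_V A = 0 (`covDeriv₂_self_apply`), and differentiating A V = 0 then turns the
Ricci identity into R(V, y)V = A²y (`curvature_self`). In parallel frames along γ the Jacobi
equation is therefore Y'' = A²Y with a constant skew A, so |Y'|² + |AY|² is conserved.

The metric is positive semidefinite on V^⊥. There AY always lies, and Y' too once V·Y is constant;
so both terms of the energy are nonnegative and |AY|² is bounded (`exists_rotationSq_le`).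
Cauchy–Schwarz on V^⊥ then bounds the product of AY with any field of constant norm in V^⊥: the e_i
give ω_{ij}Y^j up to a constant, and Z gives n·Y = 2 Z·AY.

Non-degenerate rotation forces ker A ∩ V^⊥ = ⟨V⟩ and ker A² = ker A, so the tangent space is ker A ⊕
im A. Against im A, the field Y is controlled by AY. Against a parallel K in ker A, the product Y·K
is affine in t with slope b V·K for one common b, and subtracting b t V removes this growth
(`exists_isBoundedAlong`). The condition is needed at one point only, because A is parallel.

For a causal family, g(Γ', Γ') ≤ 0 attains its maximum on the null member γ; its vanishing
transverse derivative says that V·Y is constant. The change of parameter t ↦ a(l)t adds a'(0) t V to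
the deviation vector, so a(l) = exp(-b l) yields stable trapping. The inextendible geodesic is a
maximal integral curve of V: a longer geodesic would have velocity V at the end point by continuity,
and the integral curve could be continued. -/

namespace NullKilling

/-! ### Metric, Christoffel symbols and curvature in coordinates. -/

section LocalCalculus

variable {E : Type*} [NormedAddCommGroup E] [NormedSpace ℝ E]

/-- `G` is a smooth field of symmetric non-degenerate bilinear forms on the open set `U`. -/
structure IsMetricOn (G : E → E →L[ℝ] E →L[ℝ] ℝ) (U : Set E) : Prop where
  isOpen : IsOpen U
  contDiffOn : ContDiffOn ℝ ∞ G U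
  symm : ∀ x ∈ U, ∀ u w, G x u w = G x w u
  invertible : ∀ x ∈ U, (G x).IsInvertible

/-- The Christoffel symbols as a continuous bilinear map. -/
noncomputable def christoffelL (G : E → E →L[ℝ] E →L[ℝ] ℝ) (x : E) : E →L[ℝ] E →L[ℝ] E :=
  (ContinuousLinearMap.compL ℝ E (E →L[ℝ] ℝ) E (G x).inverse).comp
    ((1 / 2 : ℝ) • (fderiv ℝ G x + (fderiv ℝ G x).flip -
      ((ContinuousLinearMap.flipₗᵢ ℝ E E ℝ).toContinuousLinearEquiv :
        (E →L[ℝ] E →L[ℝ] ℝ) →L[ℝ] E →L[ℝ] E →L[ℝ] ℝ).comp (fderiv ℝ G x).flip))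

theorem christoffelL_apply (G : E → E →L[ℝ] E →L[ℝ] ℝ) (x u v : E) :
    christoffelL G x u v = christoffel G x u v := rfl

namespace IsMetricOn

variable {G : E → E →L[ℝ] E →L[ℝ] ℝ} {U : Set E} {x : E}

theorem contDiffAt (h : IsMetricOn G U) (hx : x ∈ U) : ContDiffAt ℝ ∞ G x :=
  h.contDiffOn.contDiffAt (h.isOpen.mem_nhds hx)

theorem hasFDerivAt (h : IsMetricOn G U) (hx : x ∈ U) : HasFDerivAt G (fderiv ℝ G x) x :=
  ((h.contDiffAt hx).differentiableAt (by simp)).hasFDerivAt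

theorem fderiv_symm (h : IsMetricOn G U) (hx : x ∈ U) (z u w : E) :
    fderiv ℝ G x z u w = fderiv ℝ G x z w u := by
  have h1 : HasFDerivAt (fun y ↦ G y u w) _ x :=
    ((h.hasFDerivAt hx).clm_apply (hasFDerivAt_const u x)).clm_apply (hasFDerivAt_const w x)
  have h2 : HasFDerivAt (fun y ↦ G y w u) _ x :=
    ((h.hasFDerivAt hx).clm_apply (hasFDerivAt_const w x)).clm_apply (hasFDerivAt_const u x)
  have h3 : (fun y ↦ G y u w) =ᶠ[𝓝 x] fun y ↦ G y w u := by
    filter_upwards [h.isOpen.mem_nhds hx] with y hy using h.symm y hy u w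
  have := (h1.congr_of_eventuallyEq h3.symm).unique h2
  simpa using congr($this z)

theorem eq_of_forall (h : IsMetricOn G U) (hx : x ∈ U) {a b : E}
    (hab : ∀ w, G x a w = G x b w) : a = b := by
  obtain ⟨e, he⟩ := h.invertible x hx
  apply e.injective
  ext w
  have := hab w
  rwa [← he] at this

theorem apply_christoffel (h : IsMetricOn G U) (hx : x ∈ U) (u v w : E) :
    G x (christoffel G x u v) w =
      1 / 2 * (fderiv ℝ G x u v w + fderiv ℝ G x v u w - fderiv ℝ G x w u v) := by
  unfold christoffel
  have := (h.invertible x hx).self_apply_inverse ((1 / 2 : ℝ) •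
    (fderiv ℝ G x u v + fderiv ℝ G x v u - ((fderiv ℝ G x).flip u).flip v))
  rw [this]
  simp

theorem christoffel_comm (h : IsMetricOn G U) (hx : x ∈ U) (u v : E) :
    christoffel G x u v = christoffel G x v u := by
  refine h.eq_of_forall hx fun w ↦ ?_
  rw [h.apply_christoffel hx, h.apply_christoffel hx, h.fderiv_symm hx w u v]
  ring

/-- The Levi-Civita connection is metric. -/
theorem fderiv_apply (h : IsMetricOn G U) (hx : x ∈ U) (z u w : E) :
    fderiv ℝ G x z u w = G x (christoffel G x z u) w + G x u (christoffel G x z w) := by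
  rw [h.symm x hx u, h.apply_christoffel hx, h.apply_christoffel hx, h.fderiv_symm hx z w u]
  ring

theorem contDiffAt_christoffelL [CompleteSpace E] (h : IsMetricOn G U) (hx : x ∈ U) :
    ContDiffAt ℝ ∞ (christoffelL G) x := by
  have hD : ContDiffAt ℝ ∞ (fderiv ℝ G) x := (h.contDiffAt hx).fderiv_right (by simp)
  have hI : ContDiffAt ℝ ∞ (fun y ↦ (G y).inverse) x :=
    ((h.invertible x hx).contDiffAt_map_inverse).comp x (h.contDiffAt hx)
  have hF : ContDiffAt ℝ ∞ (fun y ↦ (fderiv ℝ G y).flip) x :=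
    ((ContinuousLinearMap.flipₗᵢ ℝ E E (E →L[ℝ] ℝ)).contDiff.contDiffAt).comp x hD
  unfold christoffelL
  refine ContDiffAt.clm_comp ?_ ?_
  · exact ((ContinuousLinearMap.compL ℝ E (E →L[ℝ] ℝ) E).contDiff.contDiffAt).comp x hI
  · exact ContDiffAt.const_smul (1 / 2 : ℝ) ((hD.add hF).sub (contDiffAt_const.clm_comp hF))

theorem hasFDerivAt_christoffelL [CompleteSpace E] (h : IsMetricOn G U) (hx : x ∈ U) :
    HasFDerivAt (christoffelL G) (fderiv ℝ (christoffelL G) x) x :=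
  ((h.contDiffAt_christoffelL hx).differentiableAt (by simp)).hasFDerivAt

theorem fderiv_christoffelL_comm [CompleteSpace E] (h : IsMetricOn G U) (hx : x ∈ U) (z u v : E) :
    fderiv ℝ (christoffelL G) x z u v = fderiv ℝ (christoffelL G) x z v u := by
  have h1 : HasFDerivAt (fun y ↦ christoffelL G y u v) _ x :=
    ((h.hasFDerivAt_christoffelL hx).clm_apply (hasFDerivAt_const u x)).clm_apply
      (hasFDerivAt_const v x)
  have h2 : HasFDerivAt (fun y ↦ christoffelL G y v u) _ x :=
    ((h.hasFDerivAt_christoffelL hx).clm_apply (hasFDerivAt_const v x)).clm_apply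
      (hasFDerivAt_const u x)
  have h3 : (fun y ↦ christoffelL G y u v) =ᶠ[𝓝 x] fun y ↦ christoffelL G y v u := by
    filter_upwards [h.isOpen.mem_nhds hx] with y hy using h.christoffel_comm hy u v
  have := (h1.congr_of_eventuallyEq h3.symm).unique h2
  simpa using congr($this z)

theorem curvature_eq [CompleteSpace E] (h : IsMetricOn G U) (hx : x ∈ U) (u v w : E) :
    curvature G x u v w = fderiv ℝ (christoffelL G) x u v w - fderiv ℝ (christoffelL G) x v u w
      + christoffel G x u (christoffel G x v w) - christoffel G x v (christoffel G x u w) := by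
  have key : ∀ a b c, fderiv ℝ (fun y ↦ christoffel G y a b) x c =
      fderiv ℝ (christoffelL G) x c a b := by
    intro a b c
    have h1 : HasFDerivAt (fun y ↦ christoffelL G y a b) _ x :=
      ((h.hasFDerivAt_christoffelL hx).clm_apply (hasFDerivAt_const a x)).clm_apply
        (hasFDerivAt_const b x)
    have := congr($(h1.fderiv) c)
    simpa [christoffelL_apply] using this
  rw [curvature, key, key]

theorem curvature_bianchi [CompleteSpace E] (h : IsMetricOn G U) (hx : x ∈ U) (u v w : E) :
    curvature G x u v w + curvature G x v w u + curvature G x w u v = 0 := by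
  simp only [h.curvature_eq hx]
  rw [h.fderiv_christoffelL_comm hx u w v, h.fderiv_christoffelL_comm hx v w u,
    h.fderiv_christoffelL_comm hx w v u, h.christoffel_comm hx w v, h.christoffel_comm hx w u,
    h.christoffel_comm hx v u]
  abel

/-- Metricity, `fderiv_apply`, is differentiated once more and antisymmetrised in the two
directions: second derivatives of `G` commute, and what remains is the curvature. -/
theorem curvature_skew [CompleteSpace E] (h : IsMetricOn G U) (hx : x ∈ U) (u v a b : E) :
    G x (curvature G x u v a) b + G x a (curvature G x u v b) = 0 := by
  have hG := h.hasFDerivAt hx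
  have hC := h.hasFDerivAt_christoffelL hx
  have hD : HasFDerivAt (fderiv ℝ G) (fderiv ℝ (fderiv ℝ G) x) x :=
    ((((h.contDiffAt hx).fderiv_right (m := ∞) (by simp))).differentiableAt
      (by simp)).hasFDerivAt
  have key : ∀ z y, fderiv ℝ (fderiv ℝ G) x z y a b =
      fderiv ℝ G x z (christoffel G x y a) b + G x (fderiv ℝ (christoffelL G) x z y a) b +
      fderiv ℝ G x z a (christoffel G x y b) + G x a (fderiv ℝ (christoffelL G) x z y b) := by
    intro z y
    have h1 : HasFDerivAt (fun q ↦ fderiv ℝ G q y a b) _ x :=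
      ((hD.clm_apply (hasFDerivAt_const y x)).clm_apply (hasFDerivAt_const a x)).clm_apply
        (hasFDerivAt_const b x)
    have hc : ∀ c, HasFDerivAt (fun q ↦ christoffelL G q y c) _ x := fun c ↦
      (hC.clm_apply (hasFDerivAt_const y x)).clm_apply (hasFDerivAt_const c x)
    have h2 : HasFDerivAt (fun q ↦ G q (christoffelL G q y a) b + G q a (christoffelL G q y b))
      _ x := ((hG.clm_apply (hc a)).clm_apply (hasFDerivAt_const b x)).add
        ((hG.clm_apply (hasFDerivAt_const a x)).clm_apply (hc b))
    have h3 : (fun q ↦ fderiv ℝ G q y a b) =ᶠ[𝓝 x]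
        fun q ↦ G q (christoffelL G q y a) b + G q a (christoffelL G q y b) := by
      filter_upwards [h.isOpen.mem_nhds hx] with q hq using h.fderiv_apply hq y a b
    have := congr($(h1.unique (h2.congr_of_eventuallyEq h3)) z)
    simp [christoffelL_apply] at this
    linarith
  have hs : fderiv ℝ (fderiv ℝ G) x u v = fderiv ℝ (fderiv ℝ G) x v u :=
    (h.contDiffAt hx).isSymmSndFDerivAt
      (by simpa using! WithTop.coe_le_coe.2 (le_top : (2 : ℕ∞) ≤ ⊤)) u v
  have k1 := key u v
  rw [hs, key v u] at k1
  simp only [h.fderiv_apply hx] at k1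
  simp only [h.curvature_eq hx, map_add, map_sub, add_apply, sub_apply]
  linarith

end IsMetricOn

end LocalCalculus

/-! ### Vector fields in coordinates; null Killing fields. -/

section LocalFields

variable {E : Type*} [NormedAddCommGroup E] [NormedSpace ℝ E]

/-- The covariant derivative `u ↦ ∇_u v` of a vector field given in coordinates. -/
noncomputable def covDeriv (G : E → E →L[ℝ] E →L[ℝ] ℝ) (v : E → E) (x : E) : E →L[ℝ] E :=
  fderiv ℝ v x + (christoffelL G x).flip (v x)

theorem covDeriv_apply (G : E → E →L[ℝ] E →L[ℝ] ℝ) (v : E → E) (x u : E) :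
    covDeriv G v x u = fderiv ℝ v x u + christoffel G x u (v x) := rfl

variable {G : E → E →L[ℝ] E →L[ℝ] ℝ} {U : Set E} {x : E} {v w : E → E}

theorem IsMetricOn.fderiv_inner (h : IsMetricOn G U) (hx : x ∈ U) (hv : DifferentiableAt ℝ v x)
    (hw : DifferentiableAt ℝ w x) (z : E) :
    fderiv ℝ (fun y ↦ G y (v y) (w y)) x z =
      G x (covDeriv G v x z) (w x) + G x (v x) (covDeriv G w x z) := by
  have h1 : HasFDerivAt (fun y ↦ G y (v y) (w y)) _ x :=
    ((h.hasFDerivAt hx).clm_apply hv.hasFDerivAt).clm_apply hw.hasFDerivAt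
  rw [h1.fderiv]
  simp [covDeriv_apply, h.fderiv_apply hx]
  ring

theorem IsMetricOn.contDiffAt_covDeriv [CompleteSpace E] (h : IsMetricOn G U) (hx : x ∈ U)
    (hv : ContDiffAt ℝ ∞ v x) : ContDiffAt ℝ ∞ (covDeriv G v) x := by
  have hF : ContDiffAt ℝ ∞ (fun y ↦ (christoffelL G y).flip) x :=
    ((ContinuousLinearMap.flipₗᵢ ℝ E E E).contDiff.contDiffAt).comp x
      (h.contDiffAt_christoffelL hx)
  exact (hv.fderiv_right (by simp)).add (hF.clm_apply hv)

theorem IsMetricOn.hasFDerivAt_covDeriv [CompleteSpace E] (h : IsMetricOn G U) (hx : x ∈ U)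
    (hv : ContDiffAt ℝ ∞ v x) : HasFDerivAt (covDeriv G v) (fderiv ℝ (covDeriv G v) x) x :=
  ((h.contDiffAt_covDeriv hx hv).differentiableAt (by simp)).hasFDerivAt

/-- The second covariant derivative `∇_z (∇ v) u`. -/
noncomputable def covDeriv₂ (G : E → E →L[ℝ] E →L[ℝ] ℝ) (v : E → E) (x z u : E) : E :=
  fderiv ℝ (covDeriv G v) x z u + christoffel G x z (covDeriv G v x u)
    - covDeriv G v x (christoffel G x z u)

/-- Second derivatives of `v` cancel by symmetry; the derivatives of the Christoffel symbols and
their products assemble into the curvature. -/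
theorem IsMetricOn.ricci_identity [CompleteSpace E] (h : IsMetricOn G U) (hx : x ∈ U)
    (hv : ContDiffAt ℝ ∞ v x) (z u : E) :
    covDeriv₂ G v x z u - covDeriv₂ G v x u z = curvature G x z u (v x) := by
  have hd := (hv.differentiableAt (by simp)).hasFDerivAt
  have key : ∀ a b, fderiv ℝ (covDeriv G v) x a b = fderiv ℝ (fderiv ℝ v) x a b +
      (fderiv ℝ (christoffelL G) x a b (v x) + christoffel G x b (fderiv ℝ v x a)) := by
    intro a b
    have hD : HasFDerivAt (fderiv ℝ v) (fderiv ℝ (fderiv ℝ v) x) x :=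
      ((hv.fderiv_right (m := ∞) (by simp)).differentiableAt (by simp)).hasFDerivAt
    have h1 : HasFDerivAt (fun y ↦ fderiv ℝ v y b + christoffelL G y b (v y)) _ x :=
      (hD.clm_apply (hasFDerivAt_const b x)).add
        (((h.hasFDerivAt_christoffelL hx).clm_apply (hasFDerivAt_const b x)).clm_apply hd)
    have h2 : HasFDerivAt (fun y ↦ covDeriv G v y b) _ x :=
      (h.hasFDerivAt_covDeriv hx hv).clm_apply (hasFDerivAt_const b x)
    have := congr($(h2.unique h1) a)
    simp [christoffelL_apply] at this
    rw [this]
    abel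
  have hs : fderiv ℝ (fderiv ℝ v) x z u = fderiv ℝ (fderiv ℝ v) x u z :=
    hv.isSymmSndFDerivAt (by simpa using! WithTop.coe_le_coe.2 (le_top : (2 : ℕ∞) ≤ ⊤)) z u
  simp only [covDeriv₂, key, h.curvature_eq hx, covDeriv_apply, hs,
    ← christoffelL_apply, map_add]
  simp only [christoffelL_apply, h.christoffel_comm hx u z]
  abel

/-- `v` is a null Killing field on `U` in coordinates. -/
structure IsNullKillingOn (G : E → E →L[ℝ] E →L[ℝ] ℝ) (U : Set E) (v : E → E) : Prop where
  contDiffOn : ContDiffOn ℝ ∞ v U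
  killing : ∀ x ∈ U, ∀ u w, G x (covDeriv G v x u) w + G x u (covDeriv G v x w) = 0
  null : ∀ x ∈ U, G x (v x) (v x) = 0

namespace IsNullKillingOn

theorem contDiffAt (hv : IsNullKillingOn G U v) (h : IsMetricOn G U) (hx : x ∈ U) :
    ContDiffAt ℝ ∞ v x :=
  hv.contDiffOn.contDiffAt (h.isOpen.mem_nhds hx)

/-- Differentiating v·v = 0 gives v·∇_w v = 0, and the Killing equation moves the derivative: ∇_v
v·w = -v·∇_w v = 0. -/
theorem covDeriv_self (hv : IsNullKillingOn G U v) (h : IsMetricOn G U) (hx : x ∈ U) :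
    covDeriv G v x (v x) = 0 := by
  refine h.eq_of_forall hx fun w ↦ ?_
  have hd := (hv.contDiffAt h hx).differentiableAt (by simp)
  have h1 := h.fderiv_inner hx hd hd w
  have h2 : (fun y ↦ G y (v y) (v y)) =ᶠ[𝓝 x] fun _ ↦ 0 := by
    filter_upwards [h.isOpen.mem_nhds hx] with y hy using hv.null y hy
  rw [h2.fderiv_eq, h.symm x hx _ (v x)] at h1
  have h3 := hv.killing x hx (v x) w
  simp at h1 ⊢
  linarith

/-- This is the derivative of A v = 0: (∇_z A)v + A(∇_z v) = 0. -/
theorem covDeriv₂_apply_self [CompleteSpace E] (hv : IsNullKillingOn G U v)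
    (h : IsMetricOn G U) (hx : x ∈ U) (z : E) :
    covDeriv₂ G v x z (v x) = - covDeriv G v x (covDeriv G v x z) := by
  have hc := hv.contDiffAt h hx
  have h1 : HasFDerivAt (fun y ↦ covDeriv G v y (v y)) _ x :=
    (h.hasFDerivAt_covDeriv hx hc).clm_apply (hc.differentiableAt (by simp)).hasFDerivAt
  have h2 : (fun y ↦ covDeriv G v y (v y)) =ᶠ[𝓝 x] fun _ ↦ 0 := by
    filter_upwards [h.isOpen.mem_nhds hx] with y hy using hv.covDeriv_self h hy
  have h3 := congr($(h1.unique ((hasFDerivAt_const 0 x).congr_of_eventuallyEq h2)) z)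
  simp at h3
  have h4 : fderiv ℝ v x z = covDeriv G v x z - christoffel G x z (v x) := by
    simp [covDeriv_apply]
  rw [h4, map_sub] at h3
  rw [covDeriv₂, hv.covDeriv_self h hx, ← christoffelL_apply G x z 0, map_zero,
    eq_neg_iff_add_eq_zero]
  refine Eq.trans ?_ h3
  abel

theorem covDeriv₂_skew [CompleteSpace E] (hv : IsNullKillingOn G U v)
    (h : IsMetricOn G U) (hx : x ∈ U) (z a b : E) :
    G x (covDeriv₂ G v x z a) b + G x a (covDeriv₂ G v x z b) = 0 := by
  have hc := h.hasFDerivAt_covDeriv hx (hv.contDiffAt h hx)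
  have hG := h.hasFDerivAt hx
  have ha : HasFDerivAt (fun y ↦ covDeriv G v y a) _ x := hc.clm_apply (hasFDerivAt_const a x)
  have hb : HasFDerivAt (fun y ↦ covDeriv G v y b) _ x := hc.clm_apply (hasFDerivAt_const b x)
  have h1 : HasFDerivAt (fun y ↦ G y (covDeriv G v y a) b + G y a (covDeriv G v y b)) _ x :=
    ((hG.clm_apply ha).clm_apply (hasFDerivAt_const b x)).add
      ((hG.clm_apply (hasFDerivAt_const a x)).clm_apply hb)
  have h2 : (fun y ↦ G y (covDeriv G v y a) b + G y a (covDeriv G v y b)) =ᶠ[𝓝 x]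
      fun _ ↦ 0 := by
    filter_upwards [h.isOpen.mem_nhds hx] with y hy using hv.killing y hy a b
  have h3 := congr($(h1.unique ((hasFDerivAt_const 0 x).congr_of_eventuallyEq h2)) z)
  simp [h.fderiv_apply hx] at h3
  have h4 := hv.killing x hx (christoffel G x z a) b
  have h5 := hv.killing x hx a (christoffel G x z b)
  simp only [covDeriv₂, map_add, map_sub, add_apply, sub_apply]
  linarith

/-- The covariant derivative of a null Killing field is parallel along the field. -/
theorem covDeriv₂_self_apply [CompleteSpace E] (hv : IsNullKillingOn G U v)
    (h : IsMetricOn G U) (hx : x ∈ U) (y : E) : covDeriv₂ G v x (v x) y = 0 := by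
  refine h.eq_of_forall hx fun z ↦ ?_
  have hc := hv.contDiffAt h hx
  -- With T(a, b, c) = (∇_a A)b·c, skew in b and c, the Ricci identity is T(a, b, c) - T(b, a, c) =
  -- R(a, b)v·c. Its three cyclic instances on v, y, z add up to 2T(v, y, z) = R(y, z)v·v by the
  -- Bianchi identity paired with v, and the right side vanishes since R(y, z) is skew.
  have r : ∀ a b c, G x (covDeriv₂ G v x a b) c - G x (covDeriv₂ G v x b a) c =
      G x (curvature G x a b (v x)) c := fun a b c ↦ by
    rw [← h.ricci_identity hx hc, map_sub, sub_apply]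
  have s := hv.covDeriv₂_skew h hx
  have k : ∀ a b c d, G x (curvature G x a b c) d = - G x (curvature G x a b d) c :=
    fun a b c d ↦ by
      rw [h.symm x hx (curvature G x a b d)]
      linarith [h.curvature_skew hx a b c d]
  have s' : ∀ a b c, G x (covDeriv₂ G v x a b) c = - G x (covDeriv₂ G v x a c) b :=
    fun a b c ↦ by rw [h.symm x hx (covDeriv₂ G v x a c)]; linarith [s a b c]
  have b1 := congr(G x $(h.curvature_bianchi hx (v x) y z) (v x))
  simp at b1
  have e1 := r (v x) y z
  have e2 := r y z (v x)
  have e3 := r z (v x) y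
  have z1 := k y z (v x) (v x)
  have z2 := k (v x) y z (v x)
  have z3 := k z (v x) y (v x)
  rw [map_zero, zero_apply]
  linarith [s' (v x) y z, s' y (v x) z, s' z (v x) y]

/-- By the Ricci identity R(v, y)v = (∇_v A)y - (∇_y A)v; the first term is zero and the second is
-A²y. -/
theorem curvature_self [CompleteSpace E] (hv : IsNullKillingOn G U v)
    (h : IsMetricOn G U) (hx : x ∈ U) (y : E) :
    curvature G x (v x) y (v x) = covDeriv G v x (covDeriv G v x y) := by
  rw [← h.ricci_identity hx (hv.contDiffAt h hx), hv.covDeriv₂_self_apply h hx,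
    hv.covDeriv₂_apply_self h hx]
  abel

end IsNullKillingOn

/-- The transformation law of the Christoffel symbols. -/
theorem IsMetricOn.fderiv_christoffel {G' : E → E →L[ℝ] E →L[ℝ] ℝ} {U' : Set E} {τ : E → E}
    (h : IsMetricOn G U) (h' : IsMetricOn G' U') (hx : x ∈ U) (hx' : τ x ∈ U')
    (hτ : ContDiffAt ℝ ∞ τ x) (hsurj : Function.Surjective (fderiv ℝ τ x))
    (hG : ∀ᶠ y in 𝓝 x, ∀ u w, G y u w = G' (τ y) (fderiv ℝ τ y u) (fderiv ℝ τ y w)) (u w : E) :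
    fderiv ℝ τ x (christoffel G x u w) =
      fderiv ℝ (fderiv ℝ τ) x u w + christoffel G' (τ x) (fderiv ℝ τ x u) (fderiv ℝ τ x w) := by
  have hd := (hτ.differentiableAt (by simp)).hasFDerivAt
  have hD : HasFDerivAt (fderiv ℝ τ) (fderiv ℝ (fderiv ℝ τ) x) x :=
    ((hτ.fderiv_right (m := ∞) (by simp)).differentiableAt (by simp)).hasFDerivAt
  have hs : ∀ a b, fderiv ℝ (fderiv ℝ τ) x a b = fderiv ℝ (fderiv ℝ τ) x b a := fun a b ↦
    hτ.isSymmSndFDerivAt (by simpa using! WithTop.coe_le_coe.2 (le_top : (2 : ℕ∞) ≤ ⊤)) a b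
  have key : ∀ z a b, fderiv ℝ G x z a b =
      fderiv ℝ G' (τ x) (fderiv ℝ τ x z) (fderiv ℝ τ x a) (fderiv ℝ τ x b) +
      G' (τ x) (fderiv ℝ (fderiv ℝ τ) x z a) (fderiv ℝ τ x b) +
      G' (τ x) (fderiv ℝ (fderiv ℝ τ) x z b) (fderiv ℝ τ x a) := by
    intro z a b
    have h1 : HasFDerivAt (fun y ↦ G y a b) _ x :=
      ((h.hasFDerivAt hx).clm_apply (hasFDerivAt_const a x)).clm_apply (hasFDerivAt_const b x)
    have h2 : HasFDerivAt (fun y ↦ G' (τ y) (fderiv ℝ τ y a) (fderiv ℝ τ y b)) _ x :=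
      (((h'.hasFDerivAt hx').comp x hd).clm_apply
        (hD.clm_apply (hasFDerivAt_const a x))).clm_apply (hD.clm_apply (hasFDerivAt_const b x))
    have h3 : (fun y ↦ G y a b) =ᶠ[𝓝 x] fun y ↦ G' (τ y) (fderiv ℝ τ y a) (fderiv ℝ τ y b) := by
      filter_upwards [hG] with y hy using hy a b
    have := congr($(h1.unique (h2.congr_of_eventuallyEq h3)) z)
    simp at this
    rw [this, h'.symm _ hx' _ (fderiv ℝ τ x a)]
    ring
  -- As Dτ is onto, testing against Dτ c suffices. In the combination defining the Christoffel
  -- symbols all D²τ terms cancel except G'(D²τ(u, w), Dτ c), which occurs twice and so absorbs the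
  -- factor 1/2.
  refine h'.eq_of_forall hx' fun c ↦ ?_
  obtain ⟨c, rfl⟩ := hsurj c
  rw [← hG.self_of_nhds, h.apply_christoffel hx, map_add, add_apply, h'.apply_christoffel hx',
    key, key, key, hs w u, hs c u, hs c w]
  ring

end LocalFields

/-! ### Two-parameter maps and geodesic deviation in coordinates. -/

section TwoParameter

variable {E : Type*} [NormedAddCommGroup E] [NormedSpace ℝ E]
  {G : E → E →L[ℝ] E →L[ℝ] ℝ} {U : Set E} {c : ℝ × ℝ → E} {q : ℝ × ℝ}

/-- The covariant derivative in the direction `b` of the partial derivative in the direction `a` of a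
map into a coordinate domain. -/
noncomputable def covPartial (G : E → E →L[ℝ] E →L[ℝ] ℝ) (c : ℝ × ℝ → E) (b a q : ℝ × ℝ) : E :=
  fderiv ℝ (fun p ↦ fderiv ℝ c p a) q b + christoffel G (c q) (fderiv ℝ c q b) (fderiv ℝ c q a)

theorem fderiv_fderiv_comm {F : Type*} [NormedAddCommGroup F] [NormedSpace ℝ F] {f : ℝ × ℝ → F}
    (hf : ContDiffAt ℝ 2 f q) (a b : ℝ × ℝ) :
    fderiv ℝ (fun p ↦ fderiv ℝ f p a) q b = fderiv ℝ (fun p ↦ fderiv ℝ f p b) q a := by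
  have hD : HasFDerivAt (fderiv ℝ f) (fderiv ℝ (fderiv ℝ f) q) q :=
    ((hf.fderiv_right (m := 1) (by norm_num)).differentiableAt (by simp)).hasFDerivAt
  rw [(hD.clm_apply (hasFDerivAt_const a q)).fderiv, (hD.clm_apply (hasFDerivAt_const b q)).fderiv]
  simpa using hf.isSymmSndFDerivAt (by simp) b a

theorem _root_.ContDiffAt.of_infty {F F' : Type*} [NormedAddCommGroup F] [NormedSpace ℝ F]
    [NormedAddCommGroup F'] [NormedSpace ℝ F'] {f : F → F'} {x : F} (hf : ContDiffAt ℝ ∞ f x) :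
    ContDiffAt ℝ 2 f x :=
  hf.of_le (WithTop.coe_le_coe.2 (le_top : (2 : ℕ∞) ≤ ⊤))

/-- Vanishing torsion for two-parameter maps. It exchanges the derivative of the deviation vector
along the geodesic with the transverse derivative of the velocity. -/
theorem IsMetricOn.covPartial_comm (h : IsMetricOn G U) (hq : c q ∈ U)
    (hc : ContDiffAt ℝ ∞ c q) (a b : ℝ × ℝ) : covPartial G c b a q = covPartial G c a b q := by
  rw [covPartial, covPartial, fderiv_fderiv_comm hc.of_infty, h.christoffel_comm hq]

theorem contDiffAt_fderiv_apply {F : Type*} [NormedAddCommGroup F] [NormedSpace ℝ F]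
    {f : ℝ × ℝ → F} (hf : ContDiffAt ℝ ∞ f q) (a : ℝ × ℝ) :
    ContDiffAt ℝ ∞ (fun p ↦ fderiv ℝ f p a) q :=
  (hf.fderiv_right (by simp)).clm_apply contDiffAt_const

theorem IsMetricOn.contDiffAt_covPartial [CompleteSpace E] (h : IsMetricOn G U) (hq : c q ∈ U)
    (hc : ContDiffAt ℝ ∞ c q) (a b : ℝ × ℝ) : ContDiffAt ℝ ∞ (covPartial G c b a) q :=
  (contDiffAt_fderiv_apply (contDiffAt_fderiv_apply hc a) b).add
    ((((h.contDiffAt_christoffelL hq).comp q hc).clm_apply (contDiffAt_fderiv_apply hc b)).clm_apply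
      (contDiffAt_fderiv_apply hc a))

theorem IsMetricOn.fderiv_covPartial [CompleteSpace E] (h : IsMetricOn G U) (hq : c q ∈ U)
    (hc : ContDiffAt ℝ ∞ c q) (a b z : ℝ × ℝ) :
    fderiv ℝ (covPartial G c b a) q z =
      fderiv ℝ (fun p ↦ fderiv ℝ (fun p ↦ fderiv ℝ c p a) p b) q z +
      (fderiv ℝ (christoffelL G) (c q) (fderiv ℝ c q z) (fderiv ℝ c q b) (fderiv ℝ c q a) +
        christoffel G (c q) (fderiv ℝ (fun p ↦ fderiv ℝ c p b) q z) (fderiv ℝ c q a) +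
        christoffel G (c q) (fderiv ℝ c q b) (fderiv ℝ (fun p ↦ fderiv ℝ c p a) q z)) := by
  have hd := fun a ↦ ((contDiffAt_fderiv_apply hc a).differentiableAt (by simp)).hasFDerivAt
  have hdd := ((contDiffAt_fderiv_apply (contDiffAt_fderiv_apply hc a) b).differentiableAt
    (by simp)).hasFDerivAt
  have h1 : HasFDerivAt (covPartial G c b a) _ q :=
    hdd.add ((((h.hasFDerivAt_christoffelL hq).comp q
      (hc.differentiableAt (by simp)).hasFDerivAt).clm_apply (hd b)).clm_apply (hd a))
  rw [h1.fderiv]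
  simp [christoffelL_apply]
  abel

/-- The geodesic deviation equation in coordinates. -/
theorem IsMetricOn.geodesic_deviation [CompleteSpace E] (h : IsMetricOn G U) (hq : c q ∈ U)
    (hc : ContDiffAt ℝ ∞ c q) {a b : ℝ × ℝ} (hgeo : ∀ᶠ p in 𝓝 q, covPartial G c b b p = 0) :
    fderiv ℝ (covPartial G c b a) q b +
      christoffel G (c q) (fderiv ℝ c q b) (covPartial G c b a q) =
      curvature G (c q) (fderiv ℝ c q b) (fderiv ℝ c q a) (fderiv ℝ c q b) := by
  have e1 := h.fderiv_covPartial hq hc a b b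
  have e2 := h.fderiv_covPartial hq hc b b a
  -- The geodesic equation holds near `q`, so it may be differentiated in the transverse direction
  -- `a`. Subtracting this from the derivative of ∇_b ∂_a c in direction `b` cancels the third
  -- derivatives and leaves the curvature.
  have e3 : fderiv ℝ (covPartial G c b b) q a = 0 := by
    have : covPartial G c b b =ᶠ[𝓝 q] fun _ ↦ 0 := hgeo
    rw [this.fderiv_eq]
    simp
  have e4 : fderiv ℝ (fun p ↦ fderiv ℝ c p b) q b =
      - christoffel G (c q) (fderiv ℝ c q b) (fderiv ℝ c q b) :=
    eq_neg_of_add_eq_zero_left hgeo.self_of_nhds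
  have hev : ∀ᶠ p in 𝓝 q, ContDiffAt ℝ 2 c p := hc.of_infty.eventually (by simp)
  have e5 : fderiv ℝ (fun p ↦ fderiv ℝ (fun p ↦ fderiv ℝ c p a) p b) q b =
      fderiv ℝ (fun p ↦ fderiv ℝ (fun p ↦ fderiv ℝ c p b) p b) q a := by
    have : (fun p ↦ fderiv ℝ (fun p ↦ fderiv ℝ c p a) p b) =ᶠ[𝓝 q]
        fun p ↦ fderiv ℝ (fun p ↦ fderiv ℝ c p b) p a := by
      filter_upwards [hev] with p hp using fderiv_fderiv_comm hp a b
    rw [this.fderiv_eq, fderiv_fderiv_comm (contDiffAt_fderiv_apply hc b).of_infty]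
  rw [e3] at e2
  have e6 := eq_neg_of_add_eq_zero_left e2.symm
  rw [e1, e5, e6, h.curvature_eq hq, covPartial, fderiv_fderiv_comm hc.of_infty a b, e4,
    h.fderiv_christoffelL_comm hq (fderiv ℝ c q b) (fderiv ℝ c q a)]
  have n1 : christoffel G (c q) (-christoffel G (c q) (fderiv ℝ c q b) (fderiv ℝ c q b))
      (fderiv ℝ c q a) = - christoffel G (c q) (fderiv ℝ c q a)
        (christoffel G (c q) (fderiv ℝ c q b) (fderiv ℝ c q b)) := by
    rw [h.christoffel_comm hq, ← christoffelL_apply, map_neg, christoffelL_apply]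
  have n2 : ∀ y z, christoffel G (c q) (fderiv ℝ c q b) (y + z) =
      christoffel G (c q) (fderiv ℝ c q b) y + christoffel G (c q) (fderiv ℝ c q b) z :=
    fun y z ↦ map_add (christoffelL G (c q) (fderiv ℝ c q b)) y z
  rw [n1, n2, h.christoffel_comm hq (fderiv ℝ c q a) (fderiv ℝ c q b),
    h.christoffel_comm hq (fderiv ℝ (fun p ↦ fderiv ℝ c p b) q a)]
  abel

theorem IsMetricOn.fderiv_inner_partial (h : IsMetricOn G U) (hq : c q ∈ U)
    (hc : ContDiffAt ℝ ∞ c q) (a b : ℝ × ℝ) :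
    fderiv ℝ (fun p ↦ G (c p) (fderiv ℝ c p b) (fderiv ℝ c p b)) q a =
      2 * G (c q) (covPartial G c a b q) (fderiv ℝ c q b) := by
  have hd := ((contDiffAt_fderiv_apply hc b).differentiableAt (by simp)).hasFDerivAt
  have h1 : HasFDerivAt (fun p ↦ G (c p) (fderiv ℝ c p b) (fderiv ℝ c p b)) _ q :=
    (((h.hasFDerivAt hq).comp q (hc.differentiableAt (by simp)).hasFDerivAt).clm_apply
      hd).clm_apply hd
  rw [h1.fderiv, covPartial]
  simp [h.fderiv_apply hq, h.symm _ hq (fderiv ℝ c q b)]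
  ring

end TwoParameter

/-! ### Linear algebra of V^⊥ for a null vector. -/

section LorentzAlgebra

variable {E : Type*} [NormedAddCommGroup E] [NormedSpace ℝ E]
  {M : Type*} [TopologicalSpace M] [ChartedSpace E M] [IsManifold 𝓘(ℝ, E) ∞ M]
  (g : LorentzMetric E M) {p : M}

theorem LorentzMetric.eq_zero_of_forall {u : TangentSpace 𝓘(ℝ, E) p}
    (h : ∀ w, g.inner p u w = 0) : u = 0 := by
  obtain ⟨τ, -, hτ⟩ := g.lorentzian p
  by_contra hu
  exact (hτ u (by rw [g.symm, h]) hu).ne' (h u)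

/-- The orthogonal complement of a null vector contains no timelike vector. -/
theorem LorentzMetric.inner_self_nonneg {v u : TangentSpace 𝓘(ℝ, E) p} (hv : v ≠ 0)
    (hvv : g.inner p v v = 0) (hvu : g.inner p v u = 0) : 0 ≤ g.inner p u u := by
  obtain ⟨τ, hτ0, hτ⟩ := g.lorentzian p
  have hvτ : g.inner p τ v ≠ 0 := fun h ↦ (hτ v h hv).ne' hvv
  -- This combination is orthogonal to the timelike `τ`, so its norm is nonnegative; as `v` is null
  -- and orthogonal to `u`, that norm is (τ·v)² u·u.
  set w := g.inner p τ v • u - g.inner p τ u • v with hw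
  have hw1 : g.inner p τ w = 0 := by simp [hw]; ring
  have hw2 : g.inner p w w = g.inner p τ v ^ 2 * g.inner p u u := by
    have := g.symm p u v
    simp [hw, hvv, hvu, this]
    ring
  have hw3 : 0 ≤ g.inner p w w := by
    by_cases h0 : w = 0
    · simp [h0]
    · exact (hτ w hw1 h0).le
  rw [hw2] at hw3
  exact nonneg_of_mul_nonneg_right hw3 (by positivity)

/-- The Cauchy–Schwarz inequality on the orthogonal complement of a null vector. -/
theorem LorentzMetric.inner_sq_le {v u w : TangentSpace 𝓘(ℝ, E) p} (hv : v ≠ 0)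
    (hvv : g.inner p v v = 0) (hvu : g.inner p v u = 0) (hvw : g.inner p v w = 0) :
    g.inner p u w ^ 2 ≤ g.inner p u u * g.inner p w w := by
  -- The form is only semidefinite here, but the discriminant argument for |u + s w|² ≥ 0 needs no
  -- more.
  have h : ∀ s : ℝ, 0 ≤ g.inner p w w * (s * s) + (2 * g.inner p u w) * s + g.inner p u u := by
    intro s
    have h1 := g.inner_self_nonneg hv hvv (u := u + s • w) (by simp [hvu, hvw])
    have h2 := g.symm p w u
    simp [h2] at h1
    linarith
  have := discrim_le_zero h
  rw [discrim] at this
  linarith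

end LorentzAlgebra

/-! ### Charts: the metric, vector fields and transition maps. -/

section Charts

variable {E : Type*} [NormedAddCommGroup E] [NormedSpace ℝ E]
  {M : Type*} [TopologicalSpace M] [ChartedSpace E M] [IsManifold 𝓘(ℝ, E) ∞ M]
  {φ ψ : OpenPartialHomeomorph M E} {q : M} {x : E}

theorem mdifferentiable_atlas (hφ : φ ∈ atlas E M) : φ.MDifferentiable 𝓘(ℝ, E) 𝓘(ℝ, E) :=
  haveI : IsManifold 𝓘(ℝ, E) 1 M := IsManifold.of_le (n := ∞) (by simp)
  mdifferentiable_of_mem_atlas hφ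

theorem mfderiv_symm_coordVec (hφ : φ ∈ atlas E M) (hq : q ∈ φ.source)
    (u : TangentSpace 𝓘(ℝ, E) q) :
    mfderiv 𝓘(ℝ, E) 𝓘(ℝ, E) φ.symm (φ q) (coordVec φ q u) = u :=
  congr($((mdifferentiable_atlas hφ).symm_comp_deriv hq) u)

theorem coordVec_mfderiv_symm (hφ : φ ∈ atlas E M) (hx : x ∈ φ.target) (a : E) :
    coordVec φ (φ.symm x) (mfderiv 𝓘(ℝ, E) 𝓘(ℝ, E) φ.symm x a) = a :=
  congr($((mdifferentiable_atlas hφ).comp_symm_deriv hx) a)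

theorem coordVec_injective (hφ : φ ∈ atlas E M) (hq : q ∈ φ.source) :
    Function.Injective (coordVec φ q) :=
  (mdifferentiable_atlas hφ).mfderiv_injective hq

theorem coordVec_surjective (hφ : φ ∈ atlas E M) (hq : q ∈ φ.source) :
    Function.Surjective (coordVec φ q) :=
  (mdifferentiable_atlas hφ).mfderiv_surjective hq

theorem coordVec_inverse (hφ : φ ∈ atlas E M) (hq : q ∈ φ.source) (a : E) :
    coordVec φ q ((coordVec φ q).inverse a) = a := by
  have : (coordVec φ q).IsInvertible :=
    ⟨(mdifferentiable_atlas hφ).mfderiv hq, rfl⟩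
  exact this.self_apply_inverse a

theorem inChart_apply (g : LorentzMetric E M) (x a b : E) :
    g.inChart φ x a b = g.inner (φ.symm x) (mfderiv 𝓘(ℝ, E) 𝓘(ℝ, E) φ.symm x a)
      (mfderiv 𝓘(ℝ, E) 𝓘(ℝ, E) φ.symm x b) := rfl

theorem inner_eq_inChart (g : LorentzMetric E M) (hφ : φ ∈ atlas E M) (hq : q ∈ φ.source)
    (u w : TangentSpace 𝓘(ℝ, E) q) :
    g.inner q u w = g.inChart φ (φ q) (coordVec φ q u) (coordVec φ q w) := by
  -- The base points `φ.symm (φ q)` and `q` are only propositionally equal; reading both tangent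
  -- spaces as `E` allows the rewrite.
  have key : ∀ p : M, p = q → ∀ a b : E, (show E →L[ℝ] E →L[ℝ] ℝ from g.inner p) a b =
      (show E →L[ℝ] E →L[ℝ] ℝ from g.inner q) a b := by
    rintro p rfl a b
    rfl
  refine Eq.trans ?_ (key _ (φ.left_inv hq) _ _).symm
  exact congr((show E →L[ℝ] E →L[ℝ] ℝ from g.inner q) $((mfderiv_symm_coordVec hφ hq u).symm)
    $((mfderiv_symm_coordVec hφ hq w).symm))

theorem contMDiffOn_atlas_symm (hφ : φ ∈ atlas E M) :
    ContMDiffOn 𝓘(ℝ, E) 𝓘(ℝ, E) ∞ φ.symm φ.target :=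
  contMDiffOn_symm_of_mem_maximalAtlas (IsManifold.subset_maximalAtlas hφ)

theorem contMDiffOn_atlas (hφ : φ ∈ atlas E M) :
    ContMDiffOn 𝓘(ℝ, E) 𝓘(ℝ, E) ∞ φ φ.source :=
  contMDiffOn_of_mem_maximalAtlas (IsManifold.subset_maximalAtlas hφ)

theorem contMDiffOn_mfderiv_symm (hφ : φ ∈ atlas E M) (a : E) :
    ContMDiffOn 𝓘(ℝ, E) 𝓘(ℝ, E).tangent ∞
      (fun x ↦ (⟨φ.symm x, mfderiv 𝓘(ℝ, E) 𝓘(ℝ, E) φ.symm x a⟩ : TangentBundle 𝓘(ℝ, E) M))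
      φ.target := by
  have h1 := (contMDiffOn_atlas_symm hφ).contMDiffOn_tangentMapWithin (m := ∞) (by simp)
    φ.open_target.uniqueMDiffOn
  have h2 : ContMDiffOn 𝓘(ℝ, E) 𝓘(ℝ, E).tangent ∞
      (fun x : E ↦ (⟨x, a⟩ : TangentBundle 𝓘(ℝ, E) E)) φ.target := by
    exact (contMDiffOn_vectorSpace_iff_contDiffOn (V := fun _ ↦ a)).2 contDiffOn_const
  refine (h1.comp h2 fun x hx ↦ hx).congr fun x hx ↦ ?_
  simp [tangentMapWithin, mfderivWithin_of_isOpen φ.open_target hx]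

theorem contMDiffOn_inner (g : LorentzMetric E M) {s : Set E} {b : E → M}
    {v w : ∀ x, TangentSpace 𝓘(ℝ, E) (b x)} (hb : ContMDiffOn 𝓘(ℝ, E) 𝓘(ℝ, E) ∞ b s)
    (hv : ContMDiffOn 𝓘(ℝ, E) 𝓘(ℝ, E).tangent ∞
      (fun x ↦ (⟨b x, v x⟩ : TangentBundle 𝓘(ℝ, E) M)) s)
    (hw : ContMDiffOn 𝓘(ℝ, E) 𝓘(ℝ, E).tangent ∞
      (fun x ↦ (⟨b x, w x⟩ : TangentBundle 𝓘(ℝ, E) M)) s) :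
    ContDiffOn ℝ ∞ (fun x ↦ g.inner (b x) (v x) (w x)) s := by
  have h := ContMDiffOn.clm_bundle_apply₂ (F₁ := E) (F₂ := E) (F₃ := ℝ)
    (E₁ := fun p : M ↦ TangentSpace 𝓘(ℝ, E) p) (E₂ := fun p : M ↦ TangentSpace 𝓘(ℝ, E) p)
    (E₃ := Bundle.Trivial M ℝ) (b := b) (ψ := fun x ↦ g.inner (b x))
    (g.contMDiff.comp_contMDiffOn hb) hv hw
  rw [← contMDiffOn_iff_contDiffOn]
  intro x hx
  have := (h x hx)
  rw [Bundle.contMDiffWithinAt_totalSpace] at this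
  exact this.2

/-- Lorentzian signature makes the map to the dual injective, and finite dimension makes it
invertible. This is the bridge from the manifold to the coordinate calculus. -/
theorem isMetricOn_inChart [FiniteDimensional ℝ E] (g : LorentzMetric E M) (hφ : φ ∈ atlas E M) :
    IsMetricOn (g.inChart φ) φ.target where
  isOpen := φ.open_target
  contDiffOn := by
    rw [contDiffOn_clm_apply]
    intro a
    rw [contDiffOn_clm_apply]
    intro b
    exact contMDiffOn_inner g (contMDiffOn_atlas_symm hφ) (contMDiffOn_mfderiv_symm hφ a)
      (contMDiffOn_mfderiv_symm hφ b)
  symm x hx u w := by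
    rw [inChart_apply, inChart_apply, g.symm]
  invertible x hx := by
    have hinj : Function.Injective (g.inChart φ x) := by
      rw [injective_iff_map_eq_zero]
      intro a ha
      have hq : φ.symm x ∈ φ.source := φ.map_target hx
      have h0 : mfderiv 𝓘(ℝ, E) 𝓘(ℝ, E) φ.symm x a = 0 := by
        refine g.eq_zero_of_forall fun w ↦ ?_
        have := congr($ha (coordVec φ (φ.symm x) w))
        rw [inner_eq_inChart g hφ hq, coordVec_mfderiv_symm hφ hx, φ.right_inv hx]
        exact this
      have := coordVec_mfderiv_symm hφ hx a
      rw [h0, map_zero] at this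
      exact this.symm
    have hfin : Module.finrank ℝ E = Module.finrank ℝ (E →L[ℝ] ℝ) := by
      rw [← (LinearMap.toContinuousLinearMap : (E →ₗ[ℝ] ℝ) ≃ₗ[ℝ] E →L[ℝ] ℝ).finrank_eq]
      exact Subspace.dual_finrank_eq.symm
    exact ⟨((g.inChart φ x).toLinearMap.linearEquivOfInjective hinj hfin).toContinuousLinearEquiv,
      by ext; rfl⟩

/-- The coordinate expression of a vector field in a chart. -/
noncomputable def fieldIn (φ : OpenPartialHomeomorph M E) (X : ∀ p : M, TangentSpace 𝓘(ℝ, E) p)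
    (x : E) : E :=
  coordVec φ (φ.symm x) (X (φ.symm x))

omit [IsManifold 𝓘(ℝ, E) ∞ M] in
theorem fieldIn_apply (hq : q ∈ φ.source) (X : ∀ p : M, TangentSpace 𝓘(ℝ, E) p) :
    fieldIn φ X (φ q) = coordVec φ q (X q) := by
  rw [fieldIn, φ.left_inv hq]

theorem contDiffOn_fieldIn (hφ : φ ∈ atlas E M) {X : ∀ p : M, TangentSpace 𝓘(ℝ, E) p}
    (hX : ContMDiff 𝓘(ℝ, E) 𝓘(ℝ, E).tangent ∞
      (fun p ↦ (⟨p, X p⟩ : TangentBundle 𝓘(ℝ, E) M))) :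
    ContDiffOn ℝ ∞ (fieldIn φ X) φ.target := by
  have h1 := (contMDiffOn_atlas hφ).contMDiffOn_tangentMapWithin (m := ∞) (by simp)
    φ.open_source.uniqueMDiffOn
  have h2 := h1.comp (hX.comp_contMDiffOn (contMDiffOn_atlas_symm hφ)) fun x hx ↦ φ.map_target hx
  rw [← contMDiffOn_iff_contDiffOn]
  refine ((contMDiff_snd_tangentBundle_modelSpace E 𝓘(ℝ, E)).comp_contMDiffOn h2).congr
    fun x hx ↦ ?_
  change mfderiv 𝓘(ℝ, E) 𝓘(ℝ, E) φ (φ.symm x) (X (φ.symm x)) =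
    mfderivWithin 𝓘(ℝ, E) 𝓘(ℝ, E) φ φ.source (φ.symm x) (X (φ.symm x))
  rw [mfderivWithin_of_isOpen φ.open_source (φ.map_target hx)]

theorem contDiffAt_transition (hφ : φ ∈ atlas E M) (hψ : ψ ∈ atlas E M) (hq : q ∈ φ.source)
    (hq' : q ∈ ψ.source) : ContDiffAt ℝ ∞ (fun x ↦ ψ (φ.symm x)) (φ q) := by
  have h1 : ContMDiffAt 𝓘(ℝ, E) 𝓘(ℝ, E) ∞ φ.symm (φ q) :=
    (contMDiffOn_atlas_symm hφ).contMDiffAt (φ.open_target.mem_nhds (φ.map_source hq))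
  have h2 : ContMDiffAt 𝓘(ℝ, E) 𝓘(ℝ, E) ∞ ψ (φ.symm (φ q)) := by
    rw [φ.left_inv hq]
    exact (contMDiffOn_atlas hψ).contMDiffAt (ψ.open_source.mem_nhds hq')
  exact (h2.comp (φ q) h1).contDiffAt

theorem fderiv_transition (hφ : φ ∈ atlas E M) (hψ : ψ ∈ atlas E M) (hq : q ∈ φ.source)
    (hq' : q ∈ ψ.source) (u : TangentSpace 𝓘(ℝ, E) q) :
    fderiv ℝ (fun x ↦ ψ (φ.symm x)) (φ q) (coordVec φ q u) = coordVec ψ q u := by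
  have h1 := (mdifferentiable_atlas hφ).mdifferentiableAt_symm (φ.map_source hq)
  have h2 := (mdifferentiable_atlas hψ).mdifferentiableAt hq'
  have h3 := (mdifferentiable_atlas hφ).mdifferentiableAt hq
  have h4 : MDifferentiableAt 𝓘(ℝ, E) 𝓘(ℝ, E) (fun x ↦ ψ (φ.symm x)) (φ q) :=
    ((contDiffAt_transition hφ hψ hq hq').differentiableAt (by simp)).mdifferentiableAt
  have h5 := mfderiv_comp_apply (x := q) h4 h3 u
  rw [mfderiv_eq_fderiv] at h5
  refine h5.symm.trans ?_
  have h6 : ((fun x ↦ ψ (φ.symm x)) ∘ φ) =ᶠ[𝓝 q] ψ := by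
    filter_upwards [φ.open_source.mem_nhds hq] with y hy
    simp [φ.left_inv hy]
  exact congr($(h6.mfderiv_eq) u)

end Charts

/-! ### Independence of covariant derivatives from the chart. -/

section ChartIndependence

variable {E : Type*} [NormedAddCommGroup E] [NormedSpace ℝ E] [FiniteDimensional ℝ E]
  [CompleteSpace E]
  {M : Type*} [TopologicalSpace M] [ChartedSpace E M] [IsManifold 𝓘(ℝ, E) ∞ M]
  {g : LorentzMetric E M}
  {φ ψ : OpenPartialHomeomorph M E} {q : M} {x : E} {γ : ℝ → M} {t : ℝ}
  {Y : ∀ t, TangentSpace 𝓘(ℝ, E) (γ t)} {Y' : TangentSpace 𝓘(ℝ, E) (γ t)}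
  {X : ∀ p : M, TangentSpace 𝓘(ℝ, E) p}

theorem chartAt_mem_atlas (q : M) : chartAt E q ∈ atlas E M := ChartedSpace.chart_mem_atlas q

theorem hasDerivAt_chart_comp (hφ : φ ∈ atlas E M) (hq : γ t ∈ φ.source)
    (hγ : MDifferentiableAt 𝓘(ℝ, ℝ) 𝓘(ℝ, E) γ t) :
    HasDerivAt (fun s ↦ φ (γ s)) (coordVec φ (γ t) (velocity γ t)) t := by
  have h1 := ((mdifferentiable_atlas hφ).mdifferentiableAt hq).hasMFDerivAt.comp t hγ.hasMFDerivAt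
  have h2 : HasFDerivAt (fun s ↦ φ (γ s))
      (show ℝ →L[ℝ] E from (mfderiv 𝓘(ℝ, E) 𝓘(ℝ, E) φ (γ t)).comp (mfderiv 𝓘(ℝ, ℝ) 𝓘(ℝ, E) γ t)) t :=
    hasMFDerivAt_iff_hasFDerivAt.1 h1
  exact h2.hasDerivAt

theorem inChart_transition (g : LorentzMetric E M) (hφ : φ ∈ atlas E M) (hψ : ψ ∈ atlas E M)
    (hq : q ∈ φ.source) (hq' : q ∈ ψ.source) :
    ∀ᶠ y in 𝓝 (φ q), ∀ u w, g.inChart φ y u w = g.inChart ψ (ψ (φ.symm y))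
      (fderiv ℝ (fun x ↦ ψ (φ.symm x)) y u) (fderiv ℝ (fun x ↦ ψ (φ.symm x)) y w) := by
  have h1 : ∀ᶠ y in 𝓝 (φ q), φ.symm y ∈ ψ.source := by
    refine (φ.continuousAt_symm (φ.map_source hq)).eventually_mem ?_
    rw [φ.left_inv hq]
    exact ψ.open_source.mem_nhds hq'
  filter_upwards [h1, φ.open_target.mem_nhds (φ.map_source hq)] with y hy hy' u w
  obtain ⟨p, hp, rfl⟩ : ∃ p ∈ φ.source, φ p = y := ⟨φ.symm y, φ.map_target hy', φ.right_inv hy'⟩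
  rw [φ.left_inv hp] at hy
  obtain ⟨u, rfl⟩ := coordVec_surjective hφ hp u
  obtain ⟨w, rfl⟩ := coordVec_surjective hφ hp w
  rw [fderiv_transition hφ hψ hp hy, fderiv_transition hφ hψ hp hy, φ.left_inv hp,
    ← inner_eq_inChart g hφ hp, ← inner_eq_inChart g hψ hy]

theorem fderiv_transition_christoffel (g : LorentzMetric E M) (hφ : φ ∈ atlas E M)
    (hψ : ψ ∈ atlas E M) (hq : q ∈ φ.source) (hq' : q ∈ ψ.source)
    (u w : TangentSpace 𝓘(ℝ, E) q) :
    fderiv ℝ (fun x ↦ ψ (φ.symm x)) (φ q)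
        (christoffel (g.inChart φ) (φ q) (coordVec φ q u) (coordVec φ q w)) =
      fderiv ℝ (fderiv ℝ (fun x ↦ ψ (φ.symm x))) (φ q) (coordVec φ q u) (coordVec φ q w) +
      christoffel (g.inChart ψ) (ψ q) (coordVec ψ q u) (coordVec ψ q w) := by
  have h := (isMetricOn_inChart g hφ).fderiv_christoffel (isMetricOn_inChart g hψ)
    (τ := fun x ↦ ψ (φ.symm x)) (φ.map_source hq)
    (by rw [φ.left_inv hq]; exact ψ.map_source hq') (contDiffAt_transition hφ hψ hq hq')
    (fun a ↦ by
      obtain ⟨u, rfl⟩ := coordVec_surjective hψ hq' a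
      exact ⟨_, fderiv_transition hφ hψ hq hq' u⟩)
    (inChart_transition g hφ hψ hq hq') (coordVec φ q u) (coordVec φ q w)
  rw [fderiv_transition hφ hψ hq hq', fderiv_transition hφ hψ hq hq', φ.left_inv hq] at h
  exact h

/-- `HasCovDerivAlong`, expressed in the chart `φ`. -/
def HasCovDerivIn (g : LorentzMetric E M) (φ : OpenPartialHomeomorph M E) (γ : ℝ → M)
    (Y : ∀ t, TangentSpace 𝓘(ℝ, E) (γ t)) (t : ℝ) (Y' : TangentSpace 𝓘(ℝ, E) (γ t)) : Prop :=
  MDifferentiableAt 𝓘(ℝ, ℝ) 𝓘(ℝ, E) γ t ∧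
  HasDerivAt (fun s ↦ coordVec φ (γ s) (Y s)) (coordVec φ (γ t) Y' -
    christoffel (g.inChart φ) (φ (γ t)) (coordVec φ (γ t) (velocity γ t))
        (coordVec φ (γ t) (Y t))) t

/-- The components change by y ↦ Dτ y. The product rule produces D²τ(γ', Y), which is exactly the
inhomogeneous term in the transformation of the Christoffel symbols. -/
theorem hasCovDerivIn_transition (hφ : φ ∈ atlas E M) (hψ : ψ ∈ atlas E M)
    (hq : γ t ∈ φ.source) (hq' : γ t ∈ ψ.source) (h : HasCovDerivIn g φ γ Y t Y') :
    HasCovDerivIn g ψ γ Y t Y' := by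
  obtain ⟨hγ, h⟩ := h
  refine ⟨hγ, ?_⟩
  have hτ := contDiffAt_transition hφ hψ hq hq'
  set τ : E → E := fun x ↦ ψ (φ.symm x) with hτ_def
  have hD : HasFDerivAt (fderiv ℝ τ) (fderiv ℝ (fderiv ℝ τ) (φ (γ t))) (φ (γ t)) :=
    ((hτ.fderiv_right (m := ∞) (by simp)).differentiableAt (by simp)).hasFDerivAt
  have h0 : HasDerivAt (fun s ↦ fderiv ℝ τ (φ (γ s)))
      (fderiv ℝ (fderiv ℝ τ) (φ (γ t)) (coordVec φ (γ t) (velocity γ t))) t :=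
    hD.comp_hasDerivAt t (hasDerivAt_chart_comp hφ hq hγ)
  have h1 := h0.clm_apply h
  have h2 : ∀ᶠ s in 𝓝 t, γ s ∈ φ.source ∩ ψ.source :=
    hγ.continuousAt.eventually_mem ((φ.open_source.inter ψ.open_source).mem_nhds ⟨hq, hq'⟩)
  have h3 : (fun s ↦ coordVec ψ (γ s) (Y s)) =ᶠ[𝓝 t]
      fun s ↦ fderiv ℝ τ (φ (γ s)) (coordVec φ (γ s) (Y s)) := by
    filter_upwards [h2] with s hs
    exact (fderiv_transition hφ hψ hs.1 hs.2 _).symm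
  refine (h1.congr_of_eventuallyEq h3).congr_deriv ?_
  have e1 := fderiv_transition hφ hψ hq hq' Y'
  have e2 := fderiv_transition_christoffel g hφ hψ hq hq' (velocity γ t) (Y t)
  rw [← hτ_def] at e1 e2
  rw [map_sub, e1, e2]
  abel

/-- The definition uses the preferred chart at γ t, which varies with `t`. To differentiate again or
solve an ODE, one chart must serve a whole neighbourhood of `t`. -/
theorem hasCovDerivAlong_iff (hφ : φ ∈ atlas E M) (hq : γ t ∈ φ.source) :
    HasCovDerivAlong g γ Y t Y' ↔ HasCovDerivIn g φ γ Y t Y' := by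
  have h : HasCovDerivAlong g γ Y t Y' ↔ HasCovDerivIn g (chartAt E (γ t)) γ Y t Y' := by
    refine and_congr_right fun _ ↦ ⟨?_, fun h ↦ ⟨_, h, by abel⟩⟩
    rintro ⟨y', h1, h2⟩
    rw [h2, add_sub_cancel_right]
    exact h1
  rw [h]
  have h1 := chartAt_mem_atlas (E := E) (γ t)
  have h2 := mem_chart_source E (γ t)
  exact ⟨hasCovDerivIn_transition h1 hφ h2 hq, hasCovDerivIn_transition hφ h1 hq h2⟩

/-- The field `X` is smooth. -/
def IsSmoothField (X : ∀ p : M, TangentSpace 𝓘(ℝ, E) p) : Prop :=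
  ContMDiff 𝓘(ℝ, E) 𝓘(ℝ, E).tangent ∞ (fun p ↦ (⟨p, X p⟩ : TangentBundle 𝓘(ℝ, E) M))

theorem IsSmoothField.contDiffAt_fieldIn (hX : IsSmoothField X) (hφ : φ ∈ atlas E M)
    (hq : q ∈ φ.source) : ContDiffAt ℝ ∞ (fieldIn φ X) (φ q) :=
  (contDiffOn_fieldIn hφ hX).contDiffAt (φ.open_target.mem_nhds (φ.map_source hq))

theorem IsSmoothField.covDeriv_transition (hX : IsSmoothField X) (hφ : φ ∈ atlas E M)
    (hψ : ψ ∈ atlas E M) (hq : q ∈ φ.source) (hq' : q ∈ ψ.source) (u : TangentSpace 𝓘(ℝ, E) q) :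
    fderiv ℝ (fun x ↦ ψ (φ.symm x)) (φ q)
        (covDeriv (g.inChart φ) (fieldIn φ X) (φ q) (coordVec φ q u)) =
      covDeriv (g.inChart ψ) (fieldIn ψ X) (ψ q) (coordVec ψ q u) := by
  have hτ := contDiffAt_transition hφ hψ hq hq'
  have hD : HasFDerivAt (fderiv ℝ (fun x ↦ ψ (φ.symm x))) _ (φ q) :=
    ((hτ.fderiv_right (m := ∞) (by simp)).differentiableAt (by simp)).hasFDerivAt
  have h1 := hD.clm_apply ((hX.contDiffAt_fieldIn hφ hq).differentiableAt (by simp)).hasFDerivAt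
  have h2 : ∀ᶠ y in 𝓝 (φ q), φ.symm y ∈ ψ.source := by
    refine (φ.continuousAt_symm (φ.map_source hq)).eventually_mem ?_
    rw [φ.left_inv hq]
    exact ψ.open_source.mem_nhds hq'
  have h3 : (fun y ↦ fieldIn ψ X (ψ (φ.symm y))) =ᶠ[𝓝 (φ q)]
      fun y ↦ fderiv ℝ (fun x ↦ ψ (φ.symm x)) y (fieldIn φ X y) := by
    filter_upwards [h2, φ.open_target.mem_nhds (φ.map_source hq)] with y hy hy'
    have := fderiv_transition hφ hψ (φ.map_target hy') hy (X (φ.symm y))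
    rw [φ.right_inv hy'] at this
    rw [fieldIn_apply hy, fieldIn, this]
  have h4 : HasFDerivAt (fun y ↦ fieldIn ψ X (ψ (φ.symm y))) _ (φ q) :=
    HasFDerivAt.comp (g := fieldIn ψ X) (φ q)
      (by
        rw [φ.left_inv hq]
        exact ((hX.contDiffAt_fieldIn hψ hq').differentiableAt (by simp)).hasFDerivAt)
      (hτ.differentiableAt (by simp)).hasFDerivAt
  have h5 := congr($(h4.unique (h1.congr_of_eventuallyEq h3)) (coordVec φ q u))
  simp only [ContinuousLinearMap.comp_apply, add_apply, ContinuousLinearMap.flip_apply] at h5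
  rw [fderiv_transition hφ hψ hq hq'] at h5
  rw [covDeriv_apply, covDeriv_apply, map_add, fieldIn_apply hq, fieldIn_apply hq',
    fderiv_transition_christoffel g hφ hψ hq hq', h5, fieldIn_apply hq]
  abel

/-- Frees `nabla` from the preferred chart at each point, so that it can be differentiated as a
function of the point. -/
theorem IsSmoothField.coordVec_nabla (hX : IsSmoothField X) (hφ : φ ∈ atlas E M)
    (hq : q ∈ φ.source) (u : TangentSpace 𝓘(ℝ, E) q) :
    coordVec φ q (nabla g X q u) =
      covDeriv (g.inChart φ) (fieldIn φ X) (φ q) (coordVec φ q u) := by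
  have h1 := chartAt_mem_atlas (E := E) q
  have h2 := mem_chart_source E q
  rw [← fderiv_transition h1 hφ h2 hq, ← hX.covDeriv_transition h1 hφ h2 hq]
  congr 1
  rw [nabla, coordVec_inverse h1 h2, covDeriv_apply, fieldIn_apply h2]
  rfl

theorem coordVec_riemann (u v w : TangentSpace 𝓘(ℝ, E) q) :
    coordVec (chartAt E q) q (riemann g q u v w) =
      curvature (g.inChart (chartAt E q)) (chartAt E q q) (coordVec (chartAt E q) q u)
        (coordVec (chartAt E q) q v) (coordVec (chartAt E q) q w) := by
  rw [riemann, coordVec_inverse (chartAt_mem_atlas q) (mem_chart_source E q)]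

end ChartIndependence

/-! ### Calculus of covariant derivatives along curves. -/

section AlongCurves

variable {E : Type*} [NormedAddCommGroup E] [NormedSpace ℝ E] [FiniteDimensional ℝ E]
  [CompleteSpace E]
  {M : Type*} [TopologicalSpace M] [ChartedSpace E M] [IsManifold 𝓘(ℝ, E) ∞ M]
  {g : LorentzMetric E M} {γ : ℝ → M} {t : ℝ}
  {Y W : ∀ t, TangentSpace 𝓘(ℝ, E) (γ t)} {Y' W' : TangentSpace 𝓘(ℝ, E) (γ t)}
  {X Z : ∀ p : M, TangentSpace 𝓘(ℝ, E) p}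

namespace HasCovDerivAlong

theorem iff_chartAt : HasCovDerivAlong g γ Y t Y' ↔
    HasCovDerivIn g (chartAt E (γ t)) γ Y t Y' :=
  hasCovDerivAlong_iff (chartAt_mem_atlas _) (mem_chart_source E _)

theorem eventually_mem_source (h : MDifferentiableAt 𝓘(ℝ, ℝ) 𝓘(ℝ, E) γ t) :
    ∀ᶠ s in 𝓝 t, γ s ∈ (chartAt E (γ t)).source :=
  h.continuousAt.eventually_mem (chart_source_mem_nhds E (γ t))

/-- The Levi-Civita connection is metric, along curves. -/
theorem inner (hY : HasCovDerivAlong g γ Y t Y') (hW : HasCovDerivAlong g γ W t W') :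
    HasDerivAt (fun s ↦ g.inner (γ s) (Y s) (W s))
      (g.inner (γ t) Y' (W t) + g.inner (γ t) (Y t) W') t := by
  obtain ⟨hγ, hY⟩ := iff_chartAt.1 hY
  obtain ⟨-, hW⟩ := iff_chartAt.1 hW
  have hφ := chartAt_mem_atlas (E := E) (γ t)
  have hq := mem_chart_source E (γ t)
  have hev := eventually_mem_source hγ
  set φ := chartAt E (γ t)
  have hG := isMetricOn_inChart g hφ
  have hx := φ.map_source hq
  have h0 : HasDerivAt (fun s ↦ g.inChart φ (φ (γ s)))
      (fderiv ℝ (g.inChart φ) (φ (γ t)) (coordVec φ (γ t) (velocity γ t))) t :=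
    HasFDerivAt.comp_hasDerivAt (l := g.inChart φ) t (hG.hasFDerivAt hx)
      (hasDerivAt_chart_comp hφ hq hγ)
  have h1 := (h0.clm_apply hY).clm_apply hW
  have h2 : (fun s ↦ g.inner (γ s) (Y s) (W s)) =ᶠ[𝓝 t] fun s ↦
      g.inChart φ (φ (γ s)) (coordVec φ (γ s) (Y s)) (coordVec φ (γ s) (W s)) := by
    filter_upwards [hev] with s hs using inner_eq_inChart g hφ hs _ _
  refine (h1.congr_of_eventuallyEq h2).congr_deriv ?_
  simp only [map_sub, add_apply, sub_apply, hG.fderiv_apply hx]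
  rw [inner_eq_inChart g hφ hq, inner_eq_inChart g hφ hq]
  ring

theorem unique {Y₁ Y₂ : TangentSpace 𝓘(ℝ, E) (γ t)} (h1 : HasCovDerivAlong g γ Y t Y₁)
    (h2 : HasCovDerivAlong g γ Y t Y₂) : Y₁ = Y₂ := by
  have := (iff_chartAt.1 h1).2.unique (iff_chartAt.1 h2).2
  exact coordVec_injective (chartAt_mem_atlas _) (mem_chart_source E _) (sub_left_inj.1 this)

theorem congr_of_eventuallyEq (h : HasCovDerivAlong g γ Y t Y') (hW : ∀ᶠ s in 𝓝 t, W s = Y s) :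
    HasCovDerivAlong g γ W t Y' := by
  rw [iff_chartAt] at h ⊢
  refine ⟨h.1, ?_⟩
  rw [hW.self_of_nhds]
  refine h.2.congr_of_eventuallyEq ?_
  filter_upwards [hW] with s hs
  rw [hs]

theorem add (hY : HasCovDerivAlong g γ Y t Y') (hW : HasCovDerivAlong g γ W t W') :
    HasCovDerivAlong g γ (fun s ↦ Y s + W s) t (Y' + W') := by
  rw [iff_chartAt] at hY hW ⊢
  refine ⟨hY.1, ?_⟩
  have h := hY.2.add hW.2
  have h1 : (fun s ↦ coordVec (chartAt E (γ t)) (γ s) (Y s + W s)) =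
      fun s ↦ coordVec (chartAt E (γ t)) (γ s) (Y s) + coordVec (chartAt E (γ t)) (γ s) (W s) := by
    ext s : 1
    exact map_add (coordVec (chartAt E (γ t)) (γ s)) _ _
  rw [h1]
  refine h.congr_deriv ?_
  rw [map_add, map_add, ← christoffelL_apply, ← christoffelL_apply, ← christoffelL_apply, map_add]
  abel

theorem smul {f : ℝ → ℝ} {f' : ℝ} (hf : HasDerivAt f f' t) (hY : HasCovDerivAlong g γ Y t Y') :
    HasCovDerivAlong g γ (fun s ↦ f s • Y s) t (f' • Y t + f t • Y') := by
  rw [iff_chartAt] at hY ⊢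
  refine ⟨hY.1, ?_⟩
  have h := hf.smul hY.2
  have h1 : (fun s ↦ coordVec (chartAt E (γ t)) (γ s) (f s • Y s)) =
      fun s ↦ f s • coordVec (chartAt E (γ t)) (γ s) (Y s) := by
    ext s : 1
    exact map_smul (coordVec (chartAt E (γ t)) (γ s)) _ _
  rw [h1]
  refine h.congr_deriv ?_
  rw [map_add, map_smul, map_smul, map_smul, ← christoffelL_apply, ← christoffelL_apply, map_smul,
    smul_sub]
  abel

theorem const_smul (c : ℝ) (hY : HasCovDerivAlong g γ Y t Y') :
    HasCovDerivAlong g γ (fun s ↦ c • Y s) t (c • Y') := by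
  simpa using smul (hasDerivAt_const t c) hY

/-- The restriction of a smooth field to a curve. -/
theorem of_field (hX : IsSmoothField X) (hγ : MDifferentiableAt 𝓘(ℝ, ℝ) 𝓘(ℝ, E) γ t) :
    HasCovDerivAlong g γ (fun s ↦ X (γ s)) t (nabla g X (γ t) (velocity γ t)) := by
  rw [iff_chartAt]
  refine ⟨hγ, ?_⟩
  have hφ := chartAt_mem_atlas (E := E) (γ t)
  have hq := mem_chart_source E (γ t)
  have hev := eventually_mem_source hγ
  set φ := chartAt E (γ t)
  have h1 := ((hX.contDiffAt_fieldIn hφ hq).differentiableAt (by simp)).hasFDerivAt.comp_hasDerivAt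
    t (hasDerivAt_chart_comp hφ hq hγ)
  have h2 : (fun s ↦ coordVec φ (γ s) (X (γ s))) =ᶠ[𝓝 t] fun s ↦ fieldIn φ X (φ (γ s)) := by
    filter_upwards [hev] with s hs using (fieldIn_apply hs X).symm
  refine (h1.congr_of_eventuallyEq h2).congr_deriv ?_
  rw [hX.coordVec_nabla hφ hq, covDeriv_apply, fieldIn_apply hq, add_sub_cancel_right]

end HasCovDerivAlong

/-- The endomorphism `u ↦ ∇_u X` of the tangent space. -/
noncomputable def nablaEnd (g : LorentzMetric E M) (X : ∀ p : M, TangentSpace 𝓘(ℝ, E) p) (p : M) :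
    Module.End ℝ (TangentSpace 𝓘(ℝ, E) p) where
  toFun := nabla g X p
  map_add' u w := by
    simp only [nabla, map_add, ← christoffelL_apply, add_apply]
    abel
  map_smul' c u := by
    simp only [nabla, map_smul, ← christoffelL_apply, smul_apply, RingHom.id_apply, map_add,
      smul_add]

@[simp]
theorem nablaEnd_apply (p : M) (u : TangentSpace 𝓘(ℝ, E) p) :
    nablaEnd g X p u = nabla g X p u := rfl

theorem mvfderiv_inner (hX : IsSmoothField X) (hZ : IsSmoothField Z) (p : M)
    (u : TangentSpace 𝓘(ℝ, E) p) :
    mvfderiv 𝓘(ℝ, E) (fun p ↦ g.inner p (X p) (Z p)) p u =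
      g.inner p (nabla g X p u) (Z p) + g.inner p (X p) (nabla g Z p u) := by
  have hφ := chartAt_mem_atlas (E := E) p
  have hq := mem_chart_source E p
  have hev := chart_source_mem_nhds E p
  set φ := chartAt E p
  have hG := isMetricOn_inChart g hφ
  have hx := φ.map_source hq
  have dX := (hX.contDiffAt_fieldIn hφ hq).differentiableAt (by simp)
  have dZ := (hZ.contDiffAt_fieldIn hφ hq).differentiableAt (by simp)
  have h1 : DifferentiableAt ℝ
      (fun y ↦ g.inChart φ y (fieldIn φ X y) (fieldIn φ Z y)) (φ p) :=
    ((hG.hasFDerivAt hx).differentiableAt.clm_apply dX).clm_apply dZ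
  have h2 := h1.mdifferentiableAt.hasMFDerivAt.comp p
    ((mdifferentiable_atlas hφ).mdifferentiableAt hq).hasMFDerivAt
  have h3 : (fun p ↦ g.inner p (X p) (Z p)) =ᶠ[𝓝 p]
      (fun y ↦ g.inChart φ y (fieldIn φ X y) (fieldIn φ Z y)) ∘ φ := by
    filter_upwards [hev] with y hy
    simp only [Function.comp_apply]
    rw [fieldIn_apply hy, fieldIn_apply hy, ← inner_eq_inChart g hφ hy]
  have h4 := (h2.congr_of_eventuallyEq h3).mfderiv
  have h5 : mvfderiv 𝓘(ℝ, E) (fun p ↦ g.inner p (X p) (Z p)) p u =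
      fderiv ℝ (fun y ↦ g.inChart φ y (fieldIn φ X y) (fieldIn φ Z y)) (φ p)
        (coordVec φ p u) := by
    rw [mfderiv_eq_fderiv] at h4
    exact congr($h4 u)
  rw [h5, hG.fderiv_inner hx dX dZ, inner_eq_inChart g hφ hq, inner_eq_inChart g hφ hq,
    hX.coordVec_nabla hφ hq, hZ.coordVec_nabla hφ hq, fieldIn_apply hq, fieldIn_apply hq]

/-- The Levi-Civita connection is torsion free. -/
theorem nabla_eq_of_mlieBracket_eq_zero (hX : IsSmoothField X) (hZ : IsSmoothField Z) {p : M}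
    (h : VectorField.mlieBracket 𝓘(ℝ, E) X Z p = 0) :
    nabla g X p (Z p) = nabla g Z p (X p) := by
  have hφ := chartAt_mem_atlas (E := E) p
  have hq := mem_chart_source E p
  have hG := isMetricOn_inChart g hφ
  have hx := (chartAt E p).map_source hq
  -- The Lie bracket on `M` unfolds to the bracket of the fields pulled back by the inverse extended
  -- chart. `P` is this pullback, which agrees with the coordinate expression near the point.
  obtain ⟨P, key, h1⟩ : ∃ P : (∀ p : M, TangentSpace 𝓘(ℝ, E) p) → E → E,
      (∀ X, P X =ᶠ[𝓝 (chartAt E p p)] fieldIn (chartAt E p) X) ∧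
      (coordVec (chartAt E p) p).inverse
        (VectorField.lieBracketWithin ℝ (P X) (P Z) univ (chartAt E p p)) = 0 := by
    refine ⟨fun X ↦ VectorField.mpullbackWithin 𝓘(ℝ, E) 𝓘(ℝ, E)
      (extChartAt 𝓘(ℝ, E) p).symm X (range 𝓘(ℝ, E)), fun X ↦ ?_, ?_⟩
    · filter_upwards [(chartAt E p).open_target.mem_nhds hx] with y hy
      have hi : (mfderiv 𝓘(ℝ, E) 𝓘(ℝ, E) (chartAt E p).symm y).IsInvertible :=
        ⟨(mdifferentiable_atlas hφ).symm.mfderiv hy, rfl⟩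
      change (mfderivWithin 𝓘(ℝ, E) 𝓘(ℝ, E) (chartAt E p).symm (range 𝓘(ℝ, E)) y).inverse
        (X ((chartAt E p).symm y)) = fieldIn (chartAt E p) X y
      rw [ModelWithCorners.range_eq_univ, mfderivWithin_univ]
      have e := coordVec_mfderiv_symm hφ hy
        ((mfderiv 𝓘(ℝ, E) 𝓘(ℝ, E) (chartAt E p).symm y).inverse (X ((chartAt E p).symm y)))
      rw [hi.self_apply_inverse] at e
      exact e.symm
    · have hs : (extChartAt 𝓘(ℝ, E) p).symm ⁻¹' univ ∩ range 𝓘(ℝ, E) = univ := by simp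
      rw [← hs]
      exact h
  have h2 := congrArg (coordVec (chartAt E p) p) h1
  rw [coordVec_inverse hφ hq, map_zero, VectorField.lieBracketWithin_univ] at h2
  rw [(key X).lieBracket_vectorField_eq (key Z), VectorField.lieBracket_eq] at h2
  apply coordVec_injective hφ hq
  rw [hX.coordVec_nabla hφ hq, hZ.coordVec_nabla hφ hq, covDeriv_apply, covDeriv_apply,
    fieldIn_apply hq, fieldIn_apply hq, hG.christoffel_comm hx]
  simp only [fieldIn_apply hq] at h2
  rw [sub_eq_zero.1 h2]

end AlongCurves

/-! ### The null Killing field on the manifold; uniqueness of parallel fields. -/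

section Killing

variable {E : Type*} [NormedAddCommGroup E] [NormedSpace ℝ E] [FiniteDimensional ℝ E]
  [CompleteSpace E]
  {M : Type*} [TopologicalSpace M] [ChartedSpace E M] [IsManifold 𝓘(ℝ, E) ∞ M]
  {g : LorentzMetric E M} {V : ∀ p : M, TangentSpace 𝓘(ℝ, E) p}
  {γ : ℝ → M} {J : Set ℝ} {t : ℝ}

namespace IsKilling

theorem smooth (hV : IsKilling g V) : IsSmoothField V := hV.contMDiff

theorem isNullKillingOn (hV : IsKilling g V) (hnull : IsGloballyNull g V)
    {φ : OpenPartialHomeomorph M E} (hφ : φ ∈ atlas E M) :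
    IsNullKillingOn (g.inChart φ) φ.target (fieldIn φ V) where
  contDiffOn := contDiffOn_fieldIn hφ hV.smooth
  killing x hx u w := by
    obtain ⟨p, hp, rfl⟩ : ∃ p ∈ φ.source, φ p = x := ⟨φ.symm x, φ.map_target hx, φ.right_inv hx⟩
    obtain ⟨u, rfl⟩ := coordVec_surjective hφ hp u
    obtain ⟨w, rfl⟩ := coordVec_surjective hφ hp w
    rw [← hV.smooth.coordVec_nabla hφ hp, ← hV.smooth.coordVec_nabla hφ hp,
      ← inner_eq_inChart g hφ hp, ← inner_eq_inChart g hφ hp, hV.killing]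
  null x hx := by
    obtain ⟨p, hp, rfl⟩ : ∃ p ∈ φ.source, φ p = x := ⟨φ.symm x, φ.map_target hx, φ.right_inv hx⟩
    rw [fieldIn_apply hp, ← inner_eq_inChart g hφ hp, (hnull p).2]

theorem inner_nabla (hV : IsKilling g V) (p : M) (u w : TangentSpace 𝓘(ℝ, E) p) :
    g.inner p (nabla g V p u) w = - g.inner p u (nabla g V p w) := by
  linarith [hV.killing p u w]

theorem inner_nabla_self (hV : IsKilling g V) (p : M) (u : TangentSpace 𝓘(ℝ, E) p) :
    g.inner p (nabla g V p u) u = 0 := by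
  linarith [hV.killing p u u, g.symm p (nabla g V p u) u]

theorem nabla_self (hV : IsKilling g V) (hnull : IsGloballyNull g V) (p : M) :
    nabla g V p (V p) = 0 := by
  have hφ := chartAt_mem_atlas (E := E) p
  have hq := mem_chart_source E p
  apply coordVec_injective hφ hq
  rw [hV.smooth.coordVec_nabla hφ hq, map_zero, ← fieldIn_apply hq]
  exact (hV.isNullKillingOn hnull hφ).covDeriv_self (isMetricOn_inChart g hφ)
    ((chartAt E p).map_source hq)

/-- Skewness moves A onto V, where it vanishes. This puts im A inside V^⊥, on which the metric is
semidefinite. -/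
theorem inner_self_nabla (hV : IsKilling g V) (hnull : IsGloballyNull g V) (p : M)
    (u : TangentSpace 𝓘(ℝ, E) p) : g.inner p (V p) (nabla g V p u) = 0 := by
  have := hV.inner_nabla p (V p) u
  rw [hV.nabla_self hnull, map_zero, zero_apply] at this
  linarith

theorem riemann_self (hV : IsKilling g V) (hnull : IsGloballyNull g V) (p : M)
    (y : TangentSpace 𝓘(ℝ, E) p) :
    riemann g p (V p) y (V p) = nabla g V p (nabla g V p y) := by
  have hφ := chartAt_mem_atlas (E := E) p
  have hq := mem_chart_source E p
  apply coordVec_injective hφ hq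
  rw [hV.smooth.coordVec_nabla hφ hq, hV.smooth.coordVec_nabla hφ hq, coordVec_riemann,
    ← fieldIn_apply hq]
  exact (hV.isNullKillingOn hnull hφ).curvature_self (isMetricOn_inChart g hφ)
    ((chartAt E p).map_source hq) _

/-- The covariant derivative of a null Killing field is parallel along its integral curves. -/
theorem hasCovDerivAlong_nabla (hV : IsKilling g V) (hnull : IsGloballyNull g V)
    (hγV : velocity γ t = V (γ t)) {Y : ∀ t, TangentSpace 𝓘(ℝ, E) (γ t)}
    {Y' : TangentSpace 𝓘(ℝ, E) (γ t)} (hY : HasCovDerivAlong g γ Y t Y') :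
    HasCovDerivAlong g γ (fun s ↦ nabla g V (γ s) (Y s)) t (nabla g V (γ t) Y') := by
  rw [HasCovDerivAlong.iff_chartAt] at hY ⊢
  obtain ⟨hγ, hY⟩ := hY
  refine ⟨hγ, ?_⟩
  have hφ := chartAt_mem_atlas (E := E) (γ t)
  have hq := mem_chart_source E (γ t)
  have hev := HasCovDerivAlong.eventually_mem_source hγ
  set φ := chartAt E (γ t)
  have hx := φ.map_source hq
  have hG := isMetricOn_inChart g hφ
  have hvc := hV.smooth.contDiffAt_fieldIn hφ hq
  have h0 : HasDerivAt (fun s ↦ covDeriv (g.inChart φ) (fieldIn φ V) (φ (γ s)))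
      (fderiv ℝ (covDeriv (g.inChart φ) (fieldIn φ V)) (φ (γ t))
        (coordVec φ (γ t) (velocity γ t))) t :=
    HasFDerivAt.comp_hasDerivAt (l := covDeriv (g.inChart φ) (fieldIn φ V)) t
      (hG.hasFDerivAt_covDeriv hx hvc) (hasDerivAt_chart_comp hφ hq hγ)
  have h1 := h0.clm_apply hY
  have h2 : (fun s ↦ coordVec φ (γ s) (nabla g V (γ s) (Y s))) =ᶠ[𝓝 t]
      fun s ↦ covDeriv (g.inChart φ) (fieldIn φ V) (φ (γ s)) (coordVec φ (γ s) (Y s)) := by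
    filter_upwards [hev] with s hs using hV.smooth.coordVec_nabla hφ hs _
  refine (h1.congr_of_eventuallyEq h2).congr_deriv ?_
  -- Here ∇_V A = 0 enters: the derivative of the matrix of A along γ is its commutator with the
  -- Christoffel matrix.
  have h3 := (hV.isNullKillingOn hnull hφ).covDeriv₂_self_apply hG hx (coordVec φ (γ t) (Y t))
  rw [covDeriv₂, fieldIn_apply hq, ← hγV, sub_eq_zero] at h3
  rw [hV.smooth.coordVec_nabla hφ hq, hV.smooth.coordVec_nabla hφ hq, map_sub, ← h3]
  abel

end IsKilling

theorem _root_.IsMIntegralCurveOn.hasMFDerivAt_of_isOpen (h : IsMIntegralCurveOn γ V J)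
    (hJ : IsOpen J) (ht : t ∈ J) : HasMFDerivAt 𝓘(ℝ, ℝ) 𝓘(ℝ, E) γ t
      ((1 : ℝ →L[ℝ] ℝ).smulRight (V (γ t))) :=
  (h t ht).hasMFDerivAt (hJ.mem_nhds ht)

theorem _root_.IsMIntegralCurveOn.mdifferentiableAt (h : IsMIntegralCurveOn γ V J)
    (hJ : IsOpen J) (ht : t ∈ J) : MDifferentiableAt 𝓘(ℝ, ℝ) 𝓘(ℝ, E) γ t :=
  (h.hasMFDerivAt_of_isOpen hJ ht).mdifferentiableAt

theorem _root_.HasMFDerivAt.velocity_eq {v : TangentSpace 𝓘(ℝ, E) (γ t)}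
    (h : HasMFDerivAt 𝓘(ℝ, ℝ) 𝓘(ℝ, E) γ t ((1 : ℝ →L[ℝ] ℝ).smulRight v)) :
    velocity γ t = v := by
  rw [velocity, h.mfderiv]
  exact one_smul ℝ v

theorem _root_.IsMIntegralCurveOn.velocity_eq (h : IsMIntegralCurveOn γ V J)
    (hJ : IsOpen J) (ht : t ∈ J) : velocity γ t = V (γ t) :=
  (h.hasMFDerivAt_of_isOpen hJ ht).velocity_eq

/-- A parallel field which vanishes somewhere vanishes everywhere. -/
theorem IsParallelOn.eq_zero (hV : IsSmoothField V) (hJ : IsOpen J) (hJc : J.OrdConnected)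
    (hγ : IsMIntegralCurveOn γ V J) {W : ∀ t, TangentSpace 𝓘(ℝ, E) (γ t)}
    (hW : IsParallelOn g γ J W) {t₀ : ℝ} (ht₀ : t₀ ∈ J) (h0 : W t₀ = 0) :
    ∀ t ∈ J, W t = 0 := by
  have hpre : IsPreconnected J := isPreconnected_iff_ordConnected.2 hJc
  -- The zero set is open by uniqueness for ODEs and relatively closed by continuity, and `J` is
  -- connected.
  have hsub : J ⊆ {t | t ∈ J ∧ W t = 0} := by
    refine hpre.subset_of_closure_inter_subset ?_ ⟨t₀, ht₀, ht₀, h0⟩ ?_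
    · rw [isOpen_iff_mem_nhds]
      rintro t ⟨ht, hWt⟩
      have hφ := chartAt_mem_atlas (E := E) (γ t)
      have hq := mem_chart_source E (γ t)
      have hγt := hγ.mdifferentiableAt hJ ht
      have hev := HasCovDerivAlong.eventually_mem_source hγt
      set φ := chartAt E (γ t)
      have hG := isMetricOn_inChart g hφ
      have hx := φ.map_source hq
      -- In the chart, parallel transport is the linear equation y' = L(s)y; continuity of `L` gives
      -- a uniform Lipschitz constant near `t`.
      let L : ℝ → E →L[ℝ] E := fun s ↦
        - christoffelL (g.inChart φ) (φ (γ s)) (fieldIn φ V (φ (γ s)))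
      have hL : ContinuousAt L t := by
        have h1 : ContinuousAt (fun s ↦ φ (γ s)) t :=
          (hasDerivAt_chart_comp hφ hq hγt).continuousAt
        have h2 : ContinuousAt (fun x ↦ christoffelL (g.inChart φ) x (fieldIn φ V x)) (φ (γ t)) :=
          ((hG.contDiffAt_christoffelL hx).continuousAt).clm_apply
            (hV.contDiffAt_fieldIn hφ hq).continuousAt
        exact (ContinuousAt.comp (f := fun s ↦ φ (γ s)) h2 h1).neg
      have hK : ∀ᶠ s in 𝓝 t, ‖L s‖ < ‖L t‖ + 1 :=
        hL.norm.eventually_lt continuousAt_const (by simp)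
      have hlip : ∀ᶠ s in 𝓝 t, LipschitzOnWith (‖L t‖ + 1).toNNReal (fun y ↦ L s y) univ := by
        filter_upwards [hK] with s hs
        refine LipschitzWith.lipschitzOnWith ((L s).lipschitz.weaken ?_)
        rw [← norm_toNNReal]
        exact Real.toNNReal_le_toNNReal hs.le
      have hf : ∀ᶠ s in 𝓝 t, HasDerivAt (fun r ↦ coordVec φ (γ r) (W r))
          (L s (coordVec φ (γ s) (W s))) s ∧ coordVec φ (γ s) (W s) ∈ (univ : Set E) := by
        filter_upwards [hev, hJ.mem_nhds ht] with s hs hsJ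
        refine ⟨?_, mem_univ _⟩
        have h1 := ((hasCovDerivAlong_iff hφ hs).1 (hW s hsJ)).2
        rw [map_zero, hγ.velocity_eq hJ hsJ] at h1
        refine h1.congr_deriv ?_
        simp [L, christoffelL_apply, fieldIn_apply hs]
      have hg : ∀ᶠ s in 𝓝 t, HasDerivAt (fun _ : ℝ ↦ (0 : E)) (L s 0) s ∧
          (0 : E) ∈ (univ : Set E) := by
        refine Eventually.of_forall fun s ↦ ⟨?_, mem_univ _⟩
        rw [map_zero]
        exact hasDerivAt_const s 0
      have heq := ODE_solution_unique_of_eventually hlip hf hg (by rw [hWt, map_zero])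
      filter_upwards [heq, hJ.mem_nhds ht, hev] with s hs hsJ hss
      refine ⟨hsJ, coordVec_injective hφ hss ?_⟩
      rw [hs, map_zero]
    · rintro t ⟨htc, ht⟩
      refine ⟨ht, ?_⟩
      have hφ := chartAt_mem_atlas (E := E) (γ t)
      have hq := mem_chart_source E (γ t)
      have h1 := ((HasCovDerivAlong.iff_chartAt).1 (hW t ht)).2.continuousAt
      apply coordVec_injective hφ hq
      rw [map_zero]
      by_contra hne
      have h2 := h1.eventually_ne hne
      obtain ⟨s, hs, hs'⟩ := mem_closure_iff_nhds.1 htc _ h2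
      exact hs (by rw [hs'.2, map_zero])
  exact fun t ht ↦ (hsub ht).2

end Killing

theorem exists_eq_const_of_hasDerivAt_zero {J : Set ℝ} (hJ : IsOpen J) (hJc : J.OrdConnected)
    {f : ℝ → ℝ} (hf : ∀ t ∈ J, HasDerivAt f 0 t) : ∃ c, ∀ t ∈ J, f t = c := by
  have hpre : IsPreconnected J := isPreconnected_iff_ordConnected.2 hJc
  exact hJ.exists_is_const_of_deriv_eq_zero hpre
    (fun t ht ↦ (hf t ht).differentiableAt.differentiableWithinAt) fun t ht ↦ (hf t ht).deriv

/-- The minimal polynomial is divisible by X at most once: if it were X²s, the hypothesis would let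
X s annihilate `f`, against minimality. So it is q or X q with q(0) ≠ 0. Up to the factor q(0), q(f)
is then the projection to ker f along im f; being a polynomial in `f`, it respects parallel
transport. -/
theorem _root_.Module.End.exists_polynomial_of_ker_sq {T : Type*} [AddCommGroup T] [Module ℝ T]
    [FiniteDimensional ℝ T] (f : Module.End ℝ T) (hf : ∀ u, f (f u) = 0 → f u = 0) :
    ∃ q : Polynomial ℝ, q.coeff 0 ≠ 0 ∧ ∀ u, f (Polynomial.aeval f q u) = 0 := by
  have hint : IsIntegral ℝ f := Algebra.IsIntegral.isIntegral f
  have hm := minpoly.aeval ℝ f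
  have hm0 := minpoly.ne_zero hint
  by_cases h0 : (minpoly ℝ f).coeff 0 = 0
  · obtain ⟨r, hr⟩ := Polynomial.X_dvd_iff.2 h0
    refine ⟨r, fun h1 ↦ ?_, fun u ↦ ?_⟩
    · obtain ⟨s, hs⟩ := Polynomial.X_dvd_iff.2 h1
      have h2 : Polynomial.aeval f (Polynomial.X * s) = 0 := by
        ext u
        rw [map_mul, Polynomial.aeval_X, Module.End.mul_apply, LinearMap.zero_apply]
        apply hf
        have := congr($hm u)
        rw [hr, hs] at this
        simpa using this
      have h3 := minpoly.dvd ℝ f h2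
      rw [hr, ← hs] at h3
      have hr0 : r ≠ 0 := by
        rintro rfl
        simp [hr] at hm0
      have h4 : Polynomial.X * r ∣ 1 * r := by rwa [one_mul]
      exact Polynomial.not_isUnit_X (isUnit_of_dvd_one ((mul_dvd_mul_iff_right hr0).1 h4))
    · have := congr($hm u)
      rw [hr] at this
      simpa using this
  · refine ⟨_, h0, fun u ↦ ?_⟩
    rw [hm]
    simp

/-! ### The Jacobi equation Y'' = A²Y and its energy. -/

section Jacobi

variable {E : Type*} [NormedAddCommGroup E] [NormedSpace ℝ E] [FiniteDimensional ℝ E]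
  [CompleteSpace E]
  {M : Type*} [TopologicalSpace M] [ChartedSpace E M] [IsManifold 𝓘(ℝ, E) ∞ M]
  {g : LorentzMetric E M} {V : ∀ p : M, TangentSpace 𝓘(ℝ, E) p}
  {γ : ℝ → M} {J : Set ℝ} {Y Y' P Q : ∀ t, TangentSpace 𝓘(ℝ, E) (γ t)}

theorem IsParallelOn.exists_inner_eq (hJ : IsOpen J) (hJc : J.OrdConnected)
    (hP : IsParallelOn g γ J P) (hQ : IsParallelOn g γ J Q) :
    ∃ c, ∀ t ∈ J, g.inner (γ t) (P t) (Q t) = c :=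
  exists_eq_const_of_hasDerivAt_zero hJ hJc fun t ht ↦
    ((hP t ht).inner (hQ t ht)).congr_deriv (by simp)

theorem IsParallelOn.add (hP : IsParallelOn g γ J P) (hQ : IsParallelOn g γ J Q) :
    IsParallelOn g γ J fun t ↦ P t + Q t := fun t ht ↦ by
  simpa using (hP t ht).add (hQ t ht)

theorem IsParallelOn.const_smul (c : ℝ) (hP : IsParallelOn g γ J P) :
    IsParallelOn g γ J fun t ↦ c • P t := fun t ht ↦ by
  simpa using (hP t ht).const_smul c

variable (hV : IsKilling g V) (hnull : IsGloballyNull g V) (hJ : IsOpen J)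
  (hJc : J.OrdConnected) (hγ : IsMIntegralCurveOn γ V J)

include hV hnull hJ hγ

namespace IsKilling

theorem isParallelOn (t : ℝ) (ht : t ∈ J) : HasCovDerivAlong g γ (fun t ↦ V (γ t)) t 0 := by
  have := HasCovDerivAlong.of_field (g := g) hV.smooth (hγ.mdifferentiableAt hJ ht)
  rwa [hγ.velocity_eq hJ ht, hV.nabla_self hnull] at this

theorem isNullGeodesicOn : IsNullGeodesicOn g γ J := by
  refine ⟨fun t ht ↦ ?_, fun t ht ↦ ?_⟩
  · refine (hV.isParallelOn hnull hJ hγ t ht).congr_of_eventuallyEq ?_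
    filter_upwards [hJ.mem_nhds ht] with s hs using hγ.velocity_eq hJ hs
  · rw [hγ.velocity_eq hJ ht]
    exact hnull (γ t)

theorem isParallelOn_nabla (hP : IsParallelOn g γ J P) :
    IsParallelOn g γ J fun t ↦ nabla g V (γ t) (P t) := fun t ht ↦ by
  have := hV.hasCovDerivAlong_nabla hnull (hγ.velocity_eq hJ ht) (hP t ht)
  rwa [← nablaEnd_apply, map_zero] at this

theorem isParallelOn_aeval (hP : IsParallelOn g γ J P) (q : Polynomial ℝ) :
    IsParallelOn g γ J fun t ↦ Polynomial.aeval (nablaEnd g V (γ t)) q (P t) := by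
  induction q using Polynomial.induction_on' with
  | add q r hq hr => simpa using hq.add hr
  | monomial n a =>
    have hn : IsParallelOn g γ J fun t ↦ (nablaEnd g V (γ t) ^ n) (P t) := by
      induction n with
      | zero => simpa using hP
      | succ n ih =>
        simp only [pow_succ', Module.End.mul_apply]
        exact hV.isParallelOn_nabla hnull hJ hγ ih
    have := hn.const_smul a
    simpa [Polynomial.aeval_monomial] using this

theorem hasCovDerivAlong_deriv (hY : IsJacobiFieldOn g γ J Y Y') {t : ℝ} (ht : t ∈ J) :
    HasCovDerivAlong g γ Y' t (nabla g V (γ t) (nabla g V (γ t) (Y t))) := by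
  have := (hY t ht).2
  rwa [hγ.velocity_eq hJ ht, hV.riemann_self hnull] at this

include hJc

/-- The derivative is 2 A²Y·Y' + 2 AY·AY', and the two terms cancel because A is skew. -/
theorem exists_jacobi_energy_eq (hY : IsJacobiFieldOn g γ J Y Y') :
    ∃ C, ∀ t ∈ J, g.inner (γ t) (Y' t) (Y' t) + rotationSq g V (γ t) (Y t) = C := by
  refine exists_eq_const_of_hasDerivAt_zero hJ hJc fun t ht ↦ ?_
  have h1 := hV.hasCovDerivAlong_deriv hnull hJ hγ hY ht
  have h2 := hV.hasCovDerivAlong_nabla hnull (hγ.velocity_eq hJ ht) (hY t ht).1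
  refine ((h1.inner h1).add (h2.inner h2)).congr_deriv ?_
  rw [g.symm _ (Y' t), g.symm _ (nabla g V (γ t) (Y t)),
    hV.inner_nabla (γ t) (Y' t), hV.inner_nabla (γ t) (nabla g V (γ t) (Y t))]
  rw [g.symm _ (Y' t), hV.inner_nabla (γ t) (nabla g V (γ t) (Y t))]
  ring

-- V is parallel, so the derivative of the constant V·Y is V·Y'. This puts Y' in V^⊥.
omit hJc in
theorem inner_deriv_eq_zero (hY : IsJacobiFieldOn g γ J Y Y')
    (hc : ∃ c : ℝ, ∀ t ∈ J, g.inner (γ t) (V (γ t)) (Y t) = c) {t : ℝ} (ht : t ∈ J) :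
    g.inner (γ t) (V (γ t)) (Y' t) = 0 := by
  obtain ⟨c, hc⟩ := hc
  have h1 := (hV.isParallelOn hnull hJ hγ t ht).inner (hY t ht).1
  have h2 : (fun t ↦ g.inner (γ t) (V (γ t)) (Y t)) =ᶠ[𝓝 t] fun _ ↦ c := by
    filter_upwards [hJ.mem_nhds ht] with s hs using hc s hs
  have h3 := h1.unique ((hasDerivAt_const t c).congr_of_eventuallyEq h2)
  simpa using h3

/-- Both terms of the energy are norms of vectors in V^⊥, hence nonnegative; the conserved total
bounds each of them. -/
theorem exists_rotationSq_le (hY : IsJacobiFieldOn g γ J Y Y')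
    (hc : ∃ c : ℝ, ∀ t ∈ J, g.inner (γ t) (V (γ t)) (Y t) = c) :
    ∃ C, ∀ t ∈ J, 0 ≤ rotationSq g V (γ t) (Y t) ∧ rotationSq g V (γ t) (Y t) ≤ C := by
  obtain ⟨C, hC⟩ := hV.exists_jacobi_energy_eq hnull hJ hJc hγ hY
  refine ⟨C, fun t ht ↦ ⟨?_, ?_⟩⟩
  · exact g.inner_self_nonneg (hnull _).1 (hnull _).2 (hV.inner_self_nabla hnull _ _)
  · have := g.inner_self_nonneg (hnull _).1 (hnull _).2
      (hV.inner_deriv_eq_zero hnull hJ hγ hY hc ht)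
    linarith [hC t ht]

end IsKilling

end Jacobi

/-! ### Bounds on Jacobi fields. -/

section Bounds

variable {E : Type*} [NormedAddCommGroup E] [NormedSpace ℝ E] [FiniteDimensional ℝ E]
  [CompleteSpace E]
  {M : Type*} [TopologicalSpace M] [ChartedSpace E M] [IsManifold 𝓘(ℝ, E) ∞ M]
  {g : LorentzMetric E M} {V : ∀ p : M, TangentSpace 𝓘(ℝ, E) p}
  {γ : ℝ → M} {J : Set ℝ} {Y Y' P Q : ∀ t, TangentSpace 𝓘(ℝ, E) (γ t)}

/-- The expansion of a vector in a null frame. -/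
theorem LorentzMetric.eq_null_frame_expansion {n : ℕ} (hn : Module.finrank ℝ E = n + 2) {p : M}
    {v k : TangentSpace 𝓘(ℝ, E) p} {e : Fin n → TangentSpace 𝓘(ℝ, E) p}
    (hvv : g.inner p v v = 0) (hkk : g.inner p k k = 0) (hvk : g.inner p v k = -1)
    (hve : ∀ i, g.inner p v (e i) = 0) (hke : ∀ i, g.inner p k (e i) = 0)
    (hee : ∀ i j, g.inner p (e i) (e j) = if i = j then 1 else 0)
    (y : TangentSpace 𝓘(ℝ, E) p) :
    ∑ j, g.inner p (e j) y • e j = y + g.inner p k y • v + g.inner p v y • k := by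
  have hn' : Module.finrank ℝ (TangentSpace 𝓘(ℝ, E) p) = n + 2 := hn
  have : FiniteDimensional ℝ (TangentSpace 𝓘(ℝ, E) p) := inferInstanceAs (FiniteDimensional ℝ E)
  let F : TangentSpace 𝓘(ℝ, E) p →ₗ[ℝ] (ℝ × ℝ) × (Fin n → ℝ) :=
    ((g.inner p v).toLinearMap.prod (g.inner p k).toLinearMap).prod
      (LinearMap.pi fun i ↦ (g.inner p (e i)).toLinearMap)
  have hev : ∀ i, g.inner p (e i) v = 0 := fun i ↦ by rw [g.symm, hve]
  have hek : ∀ i, g.inner p (e i) k = 0 := fun i ↦ by rw [g.symm, hke]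
  have hkv : g.inner p k v = -1 := by rw [g.symm, hvk]
  have hsurj : Function.Surjective F := by
    rintro ⟨⟨a, b⟩, c⟩
    -- As v·k = -1, the coefficient of `v` is minus the product with `k`, and vice versa.
    -- Injectivity of `F` then follows by counting dimensions.
    refine ⟨-b • v + -a • k + ∑ j, c j • e j, ?_⟩
    ext i <;> simp [F, hvv, hkk, hvk, hve, hke, hee, hev, hek, hkv]
  have hinj : Function.Injective F :=
    (LinearMap.injective_iff_surjective_of_finrank_eq_finrank (by simp [hn']; omega)).2 hsurj
  have hF : ∀ u, F u = ((g.inner p v u, g.inner p k u), fun i ↦ g.inner p (e i) u) :=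
    fun _ ↦ rfl
  apply hinj
  rw [hF, hF]
  ext i <;> simp [hvv, hkk, hvk, hve, hke, hee, hev, hek, hkv]

namespace IsKilling

variable (hV : IsKilling g V) (hnull : IsGloballyNull g V) (hJ : IsOpen J)
  (hJc : J.OrdConnected) (hγ : IsMIntegralCurveOn γ V J)

include hV hnull hJ hJc hγ

theorem exists_rotation_sum_le {n : ℕ} (hn : Module.finrank ℝ E = n + 2)
    (hY : IsJacobiFieldOn g γ J Y Y')
    (hc : ∃ c : ℝ, ∀ t ∈ J, g.inner (γ t) (V (γ t)) (Y t) = c)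
    {k : ∀ t, TangentSpace 𝓘(ℝ, E) (γ t)} {e : Fin n → ∀ t, TangentSpace 𝓘(ℝ, E) (γ t)}
    (hF : IsParallelNullFrame g V γ J k e) :
    ∃ C : ℝ, ∀ t ∈ J, ∀ i, |∑ j, rotation g V (γ t) (e i t) (e j t) *
      g.inner (γ t) (e j t) (Y t)| ≤ C := by
  obtain ⟨C, hC⟩ := hV.exists_rotationSq_le hnull hJ hJc hγ hY hc
  obtain ⟨c, hc⟩ := hc
  have hA := hV.isParallelOn_nabla hnull hJ hγ hF.parallel_k
  choose d hd using fun i ↦ (hF.parallel_e i).exists_inner_eq hJ hJc hA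
  -- Expanding Y in the frame and using A V = 0, the sum is e_i·AY + (V·Y) e_i·Ak. Cauchy–Schwarz
  -- against the unit vector e_i bounds the first term by √C; the second is the constant c d_i, as
  -- e_i and Ak are parallel.
  refine ⟨√C + |c| * ∑ i, |d i|, fun t ht i ↦ ?_⟩
  have h1 : ∑ j, rotation g V (γ t) (e i t) (e j t) * g.inner (γ t) (e j t) (Y t) =
      g.inner (γ t) (e i t) (nabla g V (γ t) (Y t)) + c * d i := by
    have h2 := congr(g.inner (γ t) (e i t) (nablaEnd g V (γ t)
      $(g.eq_null_frame_expansion hn (hnull (γ t)).2 (hF.null_k t ht) (hF.inner_V_k t ht)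
        (hF.inner_V_e t ht) (hF.inner_k_e t ht) (hF.inner_e_e t ht) (Y t))))
    simp only [map_add, map_sum, map_smul, nablaEnd_apply, hV.nabla_self hnull, hd i t ht,
      hc t ht, smul_eq_mul, map_zero, mul_zero, add_zero] at h2
    rw [← h2]
    exact Finset.sum_congr rfl fun j _ ↦ mul_comm _ _
  rw [h1]
  refine (abs_add_le _ _).trans (add_le_add ?_ ?_)
  · apply Real.abs_le_sqrt
    have h3 := g.inner_sq_le (hnull (γ t)).1 (hnull (γ t)).2 (hF.inner_V_e t ht i)
      (hV.inner_self_nabla hnull (γ t) (Y t))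
    rw [hF.inner_e_e t ht, if_pos rfl, one_mul] at h3
    exact h3.trans (hC t ht).2
  · rw [abs_mul]
    exact mul_le_mul_of_nonneg_left
      (Finset.single_le_sum (f := fun i ↦ |d i|) (fun _ _ ↦ abs_nonneg _) (Finset.mem_univ i))
      (abs_nonneg c)

-- V is parallel along γ, and V·∇_V Z = 0 by the Killing equation for Z.
omit hJc in
theorem hasDerivAt_inner_killing {Z : ∀ p : M, TangentSpace 𝓘(ℝ, E) p} (hZ : IsKilling g Z)
    {t : ℝ} (ht : t ∈ J) :
    HasDerivAt (fun t ↦ g.inner (γ t) (Z (γ t)) (V (γ t))) 0 t := by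
  have h1 := HasCovDerivAlong.of_field (g := g) hZ.smooth (hγ.mdifferentiableAt hJ ht)
  refine (h1.inner (hV.isParallelOn hnull hJ hγ t ht)).congr_deriv ?_
  rw [hγ.velocity_eq hJ ht, hZ.inner_nabla_self]
  simp

theorem ergosurface {Z : ∀ p : M, TangentSpace 𝓘(ℝ, E) p} (hZ : IsKilling g Z)
    (hVZ : ∀ p, VectorField.mlieBracket 𝓘(ℝ, E) V Z p = 0)
    (h0 : ∃ t₀ ∈ J, g.inner (γ t₀) (Z (γ t₀)) (V (γ t₀)) = 0)
    (hY : IsJacobiFieldOn g γ J Y Y')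
    (hc : ∃ c : ℝ, ∀ t ∈ J, g.inner (γ t) (V (γ t)) (Y t) = c) :
    (∀ t ∈ J, g.inner (γ t) (Z (γ t)) (V (γ t)) = 0) ∧
      ∃ C : ℝ, ∀ t ∈ J,
        |mvfderiv 𝓘(ℝ, E) (fun p ↦ g.inner p (Z p) (V p)) (γ t) (Y t)| ≤ C := by
  have hZV : ∀ t ∈ J, g.inner (γ t) (Z (γ t)) (V (γ t)) = 0 := by
    obtain ⟨c, hc⟩ := exists_eq_const_of_hasDerivAt_zero hJ hJc
      fun t ht ↦ hV.hasDerivAt_inner_killing hnull hJ hγ hZ ht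
    obtain ⟨t₀, ht₀, h0⟩ := h0
    intro t ht
    rw [hc t ht, ← hc t₀ ht₀, h0]
  have hcomm : ∀ p, nabla g V p (Z p) = nabla g Z p (V p) := fun p ↦
    nabla_eq_of_mlieBracket_eq_zero hV.smooth hZ.smooth (hVZ p)
  refine ⟨hZV, ?_⟩
  -- Commutation gives ∇_V Z = ∇_Z V, and Z·∇_Z V = 0 by the Killing equation for V.
  obtain ⟨d, hd⟩ : ∃ d, ∀ t ∈ J, g.inner (γ t) (Z (γ t)) (Z (γ t)) = d := by
    refine exists_eq_const_of_hasDerivAt_zero hJ hJc fun t ht ↦ ?_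
    have h1 := HasCovDerivAlong.of_field (g := g) hZ.smooth (hγ.mdifferentiableAt hJ ht)
    refine (h1.inner h1).congr_deriv ?_
    rw [hγ.velocity_eq hJ ht, g.symm _ (Z (γ t)), ← hcomm, hV.inner_nabla_self]
    simp
  obtain ⟨C, hC⟩ := hV.exists_rotationSq_le hnull hJ hJc hγ hY hc
  refine ⟨2 * √(d * C), fun t ht ↦ ?_⟩
  -- In n·Y = ∇_Y Z·V + Z·AY the first term is -Y·∇_V Z = -Y·AZ = AY·Z, equal to the second. On the
  -- ergosurface Z ∈ V^⊥, so Cauchy–Schwarz applies.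
  have h1 : mvfderiv 𝓘(ℝ, E) (fun p ↦ g.inner p (Z p) (V p)) (γ t) (Y t) =
      2 * g.inner (γ t) (Z (γ t)) (nabla g V (γ t) (Y t)) := by
    rw [mvfderiv_inner hZ.smooth hV.smooth, hZ.inner_nabla, ← hcomm,
      g.symm _ (Z (γ t)), hV.inner_nabla (γ t) (Y t)]
    ring
  rw [h1, abs_mul, abs_of_pos (two_pos : (0 : ℝ) < 2)]
  refine mul_le_mul_of_nonneg_left (Real.abs_le_sqrt ?_) two_pos.le
  have hVZ0 : g.inner (γ t) (V (γ t)) (Z (γ t)) = 0 := by rw [g.symm, hZV t ht]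
  have h2 := g.inner_sq_le (hnull (γ t)).1 (hnull (γ t)).2 hVZ0
    (hV.inner_self_nabla hnull (γ t) (Y t))
  refine h2.trans ?_
  rw [hd t ht]
  refine mul_le_mul_of_nonneg_left (hC t ht).2 ?_
  rw [← hd t ht]
  exact g.inner_self_nonneg (hnull (γ t)).1 (hnull (γ t)).2 hVZ0

omit hJ hJc hγ in
theorem eq_smul_of_nabla_eq_zero {p : M} (hr : HasNondegenerateRotation g V p)
    {u : TangentSpace 𝓘(ℝ, E) p} (hu : g.inner p (V p) u = 0) (h0 : nabla g V p u = 0) :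
    ∃ c : ℝ, u = c • V p :=
  hr u hu fun w _ ↦ by rw [rotation, h0, map_zero]

-- Au lies in V^⊥ ∩ ker A, so Au = cV. If c ≠ 0, then u·Au = 0 gives u ∈ V^⊥, and w·Au = c w·V = 0
-- for all w ∈ V^⊥; non-degeneracy makes u a multiple of V, whence Au = 0.
omit hJ hJc hγ in
theorem nabla_eq_zero_of_nabla_nabla_eq_zero {p : M} (hr : HasNondegenerateRotation g V p)
    {u : TangentSpace 𝓘(ℝ, E) p} (hu : nabla g V p (nabla g V p u) = 0) : nabla g V p u = 0 := by
  obtain ⟨c, hc⟩ := hV.eq_smul_of_nabla_eq_zero hnull hr (hV.inner_self_nabla hnull p u) hu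
  by_cases hc0 : c = 0
  · rw [hc, hc0, zero_smul]
  · have h1 := hV.inner_nabla_self p u
    rw [hc, map_smul, smul_apply, smul_eq_mul, mul_eq_zero, or_iff_right hc0] at h1
    obtain ⟨c', hc'⟩ := hr u h1 fun w hw ↦ by
      rw [rotation, hc, map_smul, g.symm, hw, smul_zero]
    rw [hc', ← nablaEnd_apply, map_smul, nablaEnd_apply, hV.nabla_self hnull, smul_zero]

omit hJ hJc hγ in
/-- On the kernel of `∇V`, every functional which vanishes on `V` is a multiple of `V · _`. -/
theorem exists_inner_eq_mul {p : M} (hr : HasNondegenerateRotation g V p)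
    {y : TangentSpace 𝓘(ℝ, E) p} (hy : g.inner p (V p) y = 0) :
    ∃ b : ℝ, ∀ u, nabla g V p u = 0 → g.inner p y u = b * g.inner p (V p) u := by
  have key : ∀ u, nabla g V p u = 0 → g.inner p (V p) u = 0 → g.inner p y u = 0 := by
    intro u hu hVu
    obtain ⟨c, rfl⟩ := hV.eq_smul_of_nabla_eq_zero hnull hr hVu hu
    rw [map_smul, g.symm, hy, smul_zero]
  -- If some kernel vector lies outside V^⊥, it fixes `b`, and `key` handles the remainder in V^⊥.
  -- Otherwise both functionals vanish on the kernel and b = 0 will do.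
  by_cases hex : ∃ u₀, nabla g V p u₀ = 0 ∧ g.inner p (V p) u₀ ≠ 0
  · obtain ⟨u₀, h0, hne⟩ := hex
    refine ⟨g.inner p y u₀ / g.inner p (V p) u₀, fun u hu ↦ ?_⟩
    have h1 := key (u - (g.inner p (V p) u / g.inner p (V p) u₀) • u₀)
      (by rw [← nablaEnd_apply, map_sub, map_smul, nablaEnd_apply, nablaEnd_apply, hu, h0]; simp)
      (by rw [map_sub, map_smul, smul_eq_mul, div_mul_cancel₀ _ hne, sub_self])
    rw [map_sub, map_smul, smul_eq_mul, sub_eq_zero] at h1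
    rw [h1]
    ring
  · push Not at hex
    exact ⟨0, fun u hu ↦ by rw [key u hu (hex u hu), zero_mul]⟩

/-- A parallel field is the sum of a parallel field in the kernel and a parallel field in the image
of `∇V`. -/
theorem exists_parallel_decomposition {t₀ : ℝ} (ht₀ : t₀ ∈ J)
    (hr : HasNondegenerateRotation g V (γ t₀)) (hP : IsParallelOn g γ J P) :
    ∃ K Q : ∀ t, TangentSpace 𝓘(ℝ, E) (γ t), IsParallelOn g γ J K ∧ IsParallelOn g γ J Q ∧
      (∀ t ∈ J, nabla g V (γ t) (K t) = 0) ∧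
      ∀ t, P t = K t + nabla g V (γ t) (Q t) := by
  have : FiniteDimensional ℝ (TangentSpace 𝓘(ℝ, E) (γ t₀)) :=
    inferInstanceAs (FiniteDimensional ℝ E)
  obtain ⟨q, hq0, hq⟩ := (nablaEnd g V (γ t₀)).exists_polynomial_of_ker_sq
    fun u hu ↦ hV.nabla_eq_zero_of_nabla_nabla_eq_zero hnull hr hu
  -- From q = X·`q.divX` + q(0) one gets P = q(0)⁻¹ q(A)P - A(q(0)⁻¹ `q.divX`(A)P).
  have hK := (hV.isParallelOn_aeval hnull hJ hγ hP q).const_smul (q.coeff 0)⁻¹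
  have hQ := (hV.isParallelOn_aeval hnull hJ hγ hP q.divX).const_smul (-(q.coeff 0)⁻¹)
  refine ⟨_, _, hK, hQ, ?_, fun t ↦ ?_⟩
  · refine (hV.isParallelOn_nabla hnull hJ hγ hK).eq_zero hV.smooth hJ hJc hγ ht₀ ?_
    rw [← nablaEnd_apply, map_smul, hq, smul_zero]
  · have h1 : Polynomial.aeval (nablaEnd g V (γ t)) q (P t) = nablaEnd g V (γ t)
        (Polynomial.aeval (nablaEnd g V (γ t)) q.divX (P t)) + q.coeff 0 • P t := by
      have h2 := congr(Polynomial.aeval (nablaEnd g V (γ t)) $(Polynomial.X_mul_divX_add q))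
      rw [← h2, map_add, map_mul, Polynomial.aeval_X, Polynomial.aeval_C, LinearMap.add_apply,
        Module.End.mul_apply, Module.algebraMap_end_apply]
    rw [h1, ← nablaEnd_apply, map_smul, smul_add, inv_smul_smul₀ hq0]
    module

theorem exists_isBoundedAlong {t₀ : ℝ} (ht₀ : t₀ ∈ J)
    (hr : HasNondegenerateRotation g V (γ t₀)) (hY : IsJacobiFieldOn g γ J Y Y')
    (hc : ∃ c : ℝ, ∀ t ∈ J, g.inner (γ t) (V (γ t)) (Y t) = c) :
    ∃ b : ℝ, IsBoundedAlong g γ J (fun t ↦ Y t - (b * t) • V (γ t)) := by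
  obtain ⟨C, hC⟩ := hV.exists_rotationSq_le hnull hJ hJc hγ hY hc
  -- On ker A, the functional Y'·_ at `t₀` is b times V·_. This `b` serves all parallel fields `P`
  -- at once.
  obtain ⟨b, hb⟩ := hV.exists_inner_eq_mul hnull hr
    (hV.inner_deriv_eq_zero hnull hJ hγ hY hc ht₀)
  refine ⟨b, fun P hP ↦ ?_⟩
  obtain ⟨K, Q, hK, hQ, hK0, hPKQ⟩ := hV.exists_parallel_decomposition hnull hJ hJc hγ ht₀ hr hP
  -- Y·AQ = -AY·Q, but Q need not lie in V^⊥. Splitting Q as well, AY·K₂ = 0 by skewness, and AY·AQ₂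
  -- is a product of vectors in V^⊥.
  obtain ⟨K₂, Q₂, hK₂, hQ₂, hK₂0, hQKQ⟩ :=
    hV.exists_parallel_decomposition hnull hJ hJc hγ ht₀ hr hQ
  have hAQ₂ := hV.isParallelOn_nabla hnull hJ hγ hQ₂
  obtain ⟨d, hd⟩ := hAQ₂.exists_inner_eq hJ hJc hAQ₂
  have hVp : IsParallelOn g γ J fun t ↦ V (γ t) := hV.isParallelOn hnull hJ hγ
  obtain ⟨m, hm⟩ := hVp.exists_inner_eq hJ hJc hK
  -- (Y'·K)' = A²Y·K = -AY·AK = 0, so Y·K is affine in `t`; its slope is b m with m = V·K.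
  obtain ⟨f, hf⟩ : ∃ f, ∀ t ∈ J, g.inner (γ t) (Y' t) (K t) = f := by
    refine exists_eq_const_of_hasDerivAt_zero hJ hJc fun t ht ↦ ?_
    refine ((hV.hasCovDerivAlong_deriv hnull hJ hγ hY ht).inner (hK t ht)).congr_deriv ?_
    rw [hV.inner_nabla, hK0 t ht]
    simp
  have hfm : f = b * m := by rw [← hf t₀ ht₀, ← hm t₀ ht₀, hb _ (hK0 t₀ ht₀)]
  obtain ⟨a, ha⟩ : ∃ a, ∀ t ∈ J, g.inner (γ t) (Y t) (K t) - b * t * m = a := by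
    refine exists_eq_const_of_hasDerivAt_zero hJ hJc fun t ht ↦ ?_
    refine (((hY t ht).1.inner (hK t ht)).sub
      (((hasDerivAt_id t).const_mul b).mul_const m)).congr_deriv ?_
    rw [hf t ht, hfm, map_zero]
    ring
  refine ⟨|a| + √(C * d), fun t ht ↦ ?_⟩
  have h1 : g.inner (γ t) (Y t - (b * t) • V (γ t)) (P t) =
      a - g.inner (γ t) (nabla g V (γ t) (Y t)) (nabla g V (γ t) (Q₂ t)) := by
    have h2 : g.inner (γ t) (nabla g V (γ t) (Y t)) (K₂ t) = 0 := by
      rw [hV.inner_nabla, hK₂0 t ht, map_zero, neg_zero]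
    have h3 : g.inner (γ t) (Y t) (nabla g V (γ t) (Q t)) =
        - g.inner (γ t) (nabla g V (γ t) (Y t)) (nabla g V (γ t) (Q₂ t)) := by
      rw [← neg_eq_iff_eq_neg, ← hV.inner_nabla, hQKQ t, map_add, h2, zero_add]
    rw [hPKQ t, map_sub, map_smul, sub_apply, smul_apply, map_add, map_add, h3, hm t ht,
      hV.inner_self_nabla hnull, ← ha t ht, smul_eq_mul]
    ring
  rw [h1]
  refine (abs_sub _ _).trans (add_le_add le_rfl (Real.abs_le_sqrt ?_))
  have h4 := g.inner_sq_le (hnull (γ t)).1 (hnull (γ t)).2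
    (hV.inner_self_nabla hnull (γ t) (Y t)) (hV.inner_self_nabla hnull (γ t) (Q₂ t))
  refine h4.trans ?_
  rw [hd t ht]
  refine mul_le_mul_of_nonneg_right (hC t ht).2 ?_
  rw [← hd t ht]
  exact g.inner_self_nonneg (hnull (γ t)).1 (hnull (γ t)).2 (hV.inner_self_nabla hnull _ _)

end IsKilling

end Bounds

/-! ### Deviation vectors of causal families and stable trapping. -/

section Deviation

variable {E : Type*} [NormedAddCommGroup E] [NormedSpace ℝ E] [FiniteDimensional ℝ E]
  [CompleteSpace E]
  {M : Type*} [TopologicalSpace M] [ChartedSpace E M] [IsManifold 𝓘(ℝ, E) ∞ M]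
  {g : LorentzMetric E M} {V : ∀ p : M, TangentSpace 𝓘(ℝ, E) p}
  {γ : ℝ → M} {J : Set ℝ} {Γ : ℝ → ℝ → M} {φ : OpenPartialHomeomorph M E}

theorem contDiffAt_chart_comp {F : ℝ × ℝ → M} {q : ℝ × ℝ} (hφ : φ ∈ atlas E M)
    (hF : ContMDiffAt 𝓘(ℝ, ℝ × ℝ) 𝓘(ℝ, E) ∞ F q) (hq : F q ∈ φ.source) :
    ContDiffAt ℝ ∞ (fun p ↦ φ (F p)) q :=
  (((contMDiffOn_atlas hφ).contMDiffAt (φ.open_source.mem_nhds hq)).comp q hF).contDiffAt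

/-- One chain rule for all the curves needed: `δ` is a line in `t` for velocities, a line in `l` for
deviation vectors, and l ↦ (l, a(l)t) after a change of parameter. -/
theorem coordVec_velocity_comp {F : ℝ × ℝ → M} {δ : ℝ → ℝ × ℝ} {δ' : ℝ × ℝ} {s : ℝ}
    (hφ : φ ∈ atlas E M) (hF : ContMDiffAt 𝓘(ℝ, ℝ × ℝ) 𝓘(ℝ, E) ∞ F (δ s))
    (hq : F (δ s) ∈ φ.source) (hδ : HasDerivAt δ δ' s) :
    coordVec φ (F (δ s)) (velocity (fun r ↦ F (δ r)) s) =
      fderiv ℝ (fun p ↦ φ (F p)) (δ s) δ' := by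
  have h1 : MDifferentiableAt 𝓘(ℝ, ℝ) 𝓘(ℝ, E) (fun r ↦ F (δ r)) s :=
    (hF.mdifferentiableAt (by simp)).comp s hδ.differentiableAt.mdifferentiableAt
  have h2 := hasDerivAt_chart_comp hφ hq h1
  have h3 : HasDerivAt (fun r ↦ φ (F (δ r))) (fderiv ℝ (fun p ↦ φ (F p)) (δ s) δ') s :=
    HasFDerivAt.comp_hasDerivAt (l := fun p ↦ φ (F p)) s
      ((contDiffAt_chart_comp hφ hF hq).differentiableAt (by simp)).hasFDerivAt hδ
  exact h2.unique h3

theorem coordVec_congr {p q : M} (h : p = q) (u : E) :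
    (show E →L[ℝ] E from coordVec φ p) u = (show E →L[ℝ] E from coordVec φ q) u := by
  subst h
  rfl

theorem hasDerivAt_line (l s : ℝ) : HasDerivAt (fun r : ℝ ↦ (l, r)) ((0, 1) : ℝ × ℝ) s :=
  (hasDerivAt_const s l).prodMk (hasDerivAt_id s)

/-- The data of a family of causal geodesics around the integral curve `γ`, on its domain `U`. -/
structure IsGeodesicFamilyOn (g : LorentzMetric E M) (γ : ℝ → M) (J : Set ℝ) (Γ : ℝ → ℝ → M)
    (U : Set (ℝ × ℝ)) : Prop where
  eq : ∀ t ∈ J, Γ 0 t = γ t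
  isOpen : IsOpen U
  mem : ∀ t ∈ J, ((0 : ℝ), t) ∈ U
  contMDiffOn : ContMDiffOn 𝓘(ℝ, ℝ × ℝ) 𝓘(ℝ, E) ∞ (fun q : ℝ × ℝ ↦ Γ q.1 q.2) U
  geodesic : ∀ q ∈ U, HasCovDerivAlong g (Γ q.1) (velocity (Γ q.1)) q.2 0
  causal : ∀ q ∈ U, g.inner (Γ q.1 q.2) (velocity (Γ q.1) q.2) (velocity (Γ q.1) q.2) ≤ 0

theorem IsCausalGeodesicFamily.exists_domain (h : IsCausalGeodesicFamily g γ J Γ) :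
    ∃ U, IsGeodesicFamilyOn g γ J Γ U := by
  obtain ⟨h1, U, h2, h3, h4, h5⟩ := h
  exact ⟨U, h1, h2, h3, h4, fun q hq ↦ (h5 q hq).1, fun q hq ↦ (h5 q hq).2⟩

namespace IsGeodesicFamilyOn

variable {U : Set (ℝ × ℝ)} {q : ℝ × ℝ} {t : ℝ}

/-- The family in the coordinates of the chart `φ`. -/
def _root_.NullKilling.coordFamily (φ : OpenPartialHomeomorph M E) (Γ : ℝ → ℝ → M)
    (q : ℝ × ℝ) : E := φ (Γ q.1 q.2)

variable (h : IsGeodesicFamilyOn g γ J Γ U)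

include h

theorem contMDiffAt (hq : q ∈ U) :
    ContMDiffAt 𝓘(ℝ, ℝ × ℝ) 𝓘(ℝ, E) ∞ (fun q : ℝ × ℝ ↦ Γ q.1 q.2) q :=
  h.contMDiffOn.contMDiffAt (h.isOpen.mem_nhds hq)

theorem eventually (hq : q ∈ U) (hs : Γ q.1 q.2 ∈ φ.source) :
    ∀ᶠ p in 𝓝 q, p ∈ U ∧ Γ p.1 p.2 ∈ φ.source :=
  (h.isOpen.eventually_mem hq).and ((h.contMDiffAt hq).continuousAt.eventually_mem
    (φ.open_source.mem_nhds hs))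

theorem contDiffAt (hφ : φ ∈ atlas E M) (hq : q ∈ U) (hs : Γ q.1 q.2 ∈ φ.source) :
    ContDiffAt ℝ ∞ (coordFamily φ Γ) q :=
  contDiffAt_chart_comp hφ (h.contMDiffAt hq) hs

theorem coordVec_velocity (hφ : φ ∈ atlas E M) (hq : q ∈ U) (hs : Γ q.1 q.2 ∈ φ.source) :
    coordVec φ (Γ q.1 q.2) (velocity (Γ q.1) q.2) = fderiv ℝ (coordFamily φ Γ) q (0, 1) :=
  coordVec_velocity_comp (F := fun q : ℝ × ℝ ↦ Γ q.1 q.2) (δ := fun r ↦ (q.1, r)) hφ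
    (h.contMDiffAt hq) hs (hasDerivAt_line q.1 q.2)

theorem covPartial_eq_zero (hφ : φ ∈ atlas E M) (hq : q ∈ U) (hs : Γ q.1 q.2 ∈ φ.source) :
    covPartial (g.inChart φ) (coordFamily φ Γ) (0, 1) (0, 1) q = 0 := by
  have h1 := ((hasCovDerivAlong_iff hφ hs).1 (h.geodesic q hq)).2
  have hev := (hasDerivAt_line q.1 q.2).continuousAt.eventually (h.eventually hq hs)
  have h2 : (fun r ↦ coordVec φ (Γ q.1 r) (velocity (Γ q.1) r)) =ᶠ[𝓝 q.2]
      fun r ↦ fderiv ℝ (coordFamily φ Γ) (q.1, r) (0, 1) := by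
    filter_upwards [hev] with r hr using h.coordVec_velocity (q := (q.1, r)) hφ hr.1 hr.2
  have h3 : HasDerivAt (fun r ↦ fderiv ℝ (coordFamily φ Γ) (q.1, r) (0, 1))
      (fderiv ℝ (fun p ↦ fderiv ℝ (coordFamily φ Γ) p (0, 1)) q (0, 1)) q.2 :=
    HasFDerivAt.comp_hasDerivAt (l := fun p ↦ fderiv ℝ (coordFamily φ Γ) p (0, 1)) q.2
      ((contDiffAt_fderiv_apply (h.contDiffAt hφ hq hs) _).differentiableAt (by simp)).hasFDerivAt
      (hasDerivAt_line q.1 q.2)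
  have h4 := h1.unique (h3.congr_of_eventuallyEq h2)
  rw [map_zero, h.coordVec_velocity hφ hq hs] at h4
  rw [covPartial, ← h4]
  simp [coordFamily]

theorem coordVec_deviation (hφ : φ ∈ atlas E M) (ht : t ∈ J) (hs : γ t ∈ φ.source) :
    coordVec φ (γ t) (deviation γ Γ t) = fderiv ℝ (coordFamily φ Γ) (0, t) (1, 0) := by
  have hs' : Γ 0 t ∈ φ.source := by rwa [h.eq t ht]
  refine (coordVec_congr (h.eq t ht).symm _).trans ?_
  exact coordVec_velocity_comp (F := fun q : ℝ × ℝ ↦ Γ q.1 q.2) (δ := fun r ↦ (r, t)) hφ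
    (h.contMDiffAt (h.mem t ht)) hs' ((hasDerivAt_id 0).prodMk (hasDerivAt_const 0 t))

theorem coordVec_deviation_reparam (hφ : φ ∈ atlas E M) (ht : t ∈ J) (hs : γ t ∈ φ.source)
    {a : ℝ → ℝ} {a' : ℝ} (ha : a 0 = 1) (ha' : HasDerivAt a a' 0) :
    coordVec φ (γ t) (deviation γ (fun l t ↦ Γ l (a l * t)) t) =
      fderiv ℝ (coordFamily φ Γ) (0, t) (1, a' * t) := by
  have hs' : Γ 0 t ∈ φ.source := by rwa [h.eq t ht]
  have h1 : Γ 0 (a 0 * t) = γ t := by rw [ha, one_mul, h.eq t ht]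
  refine (coordVec_congr h1.symm _).trans ?_
  have h2 : ((0 : ℝ), a 0 * t) = (0, t) := by rw [ha, one_mul]
  rw [← h2]
  exact coordVec_velocity_comp (F := fun q : ℝ × ℝ ↦ Γ q.1 q.2) (δ := fun l ↦ (l, a l * t)) hφ
    (by rw [h2]; exact h.contMDiffAt (h.mem t ht)) (by rwa [h2])
    ((hasDerivAt_id 0).prodMk (ha'.mul_const t))

variable (hJ : IsOpen J) (hγ : IsMIntegralCurveOn γ V J)

include hJ hγ

theorem coordVec_field (hφ : φ ∈ atlas E M) (ht : t ∈ J) (hs : γ t ∈ φ.source) :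
    coordVec φ (γ t) (V (γ t)) = fderiv ℝ (coordFamily φ Γ) (0, t) (0, 1) := by
  have hs' : Γ 0 t ∈ φ.source := by rwa [h.eq t ht]
  have h1 := hasDerivAt_chart_comp hφ hs (hγ.mdifferentiableAt hJ ht)
  have h2 : HasDerivAt (fun r ↦ coordFamily φ Γ (0, r))
      (fderiv ℝ (coordFamily φ Γ) (0, t) (0, 1)) t :=
    HasFDerivAt.comp_hasDerivAt (l := coordFamily φ Γ) t
      ((h.contDiffAt hφ (h.mem t ht) hs').differentiableAt (by simp)).hasFDerivAt
      (hasDerivAt_line 0 t)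
  have h3 : (fun s ↦ φ (γ s)) =ᶠ[𝓝 t] fun r ↦ coordFamily φ Γ (0, r) := by
    filter_upwards [hJ.mem_nhds ht] with s hs
    rw [coordFamily, h.eq s hs]
  rw [← hγ.velocity_eq hJ ht]
  exact h1.unique (h2.congr_of_eventuallyEq h3)

/-- The covariant derivative of the deviation vector, computed in the chart `φ`. -/
theorem hasCovDerivAlong_deviation (hφ : φ ∈ atlas E M) (ht : t ∈ J) (hs : γ t ∈ φ.source) :
    HasCovDerivAlong g γ (deviation γ Γ) t ((coordVec φ (γ t)).inverse
      (covPartial (g.inChart φ) (coordFamily φ Γ) (0, 1) (1, 0) (0, t))) := by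
  have hs' : Γ 0 t ∈ φ.source := by rwa [h.eq t ht]
  have hγt := hγ.mdifferentiableAt hJ ht
  rw [hasCovDerivAlong_iff hφ hs]
  refine ⟨hγt, ?_⟩
  have h2 : (fun s ↦ coordVec φ (γ s) (deviation γ Γ s)) =ᶠ[𝓝 t]
      fun s ↦ fderiv ℝ (coordFamily φ Γ) (0, s) (1, 0) := by
    filter_upwards [hJ.mem_nhds ht, hγt.continuousAt.eventually_mem (φ.open_source.mem_nhds hs)]
      with s hsJ hs using h.coordVec_deviation hφ hsJ hs
  have h3 : HasDerivAt (fun r ↦ fderiv ℝ (coordFamily φ Γ) (0, r) (1, 0))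
      (fderiv ℝ (fun p ↦ fderiv ℝ (coordFamily φ Γ) p (1, 0)) (0, t) (0, 1)) t :=
    HasFDerivAt.comp_hasDerivAt (l := fun p ↦ fderiv ℝ (coordFamily φ Γ) p (1, 0)) t
      ((contDiffAt_fderiv_apply (h.contDiffAt hφ (h.mem t ht) hs') _).differentiableAt
        (by simp)).hasFDerivAt
      (hasDerivAt_line 0 t)
  refine (h3.congr_of_eventuallyEq h2).congr_deriv ?_
  rw [coordVec_inverse hφ hs, covPartial, h.coordVec_deviation hφ ht hs, hγ.velocity_eq hJ ht,
    h.coordVec_field hJ hγ hφ ht hs, coordFamily, h.eq t ht, add_sub_cancel_right]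

theorem exists_isJacobiFieldOn (hV : IsKilling g V) (hnull : IsGloballyNull g V)
    (hJc : J.OrdConnected) :
    (∃ Y' : ∀ t, TangentSpace 𝓘(ℝ, E) (γ t), IsJacobiFieldOn g γ J (deviation γ Γ) Y') ∧
      ∃ c : ℝ, ∀ t ∈ J, g.inner (γ t) (V (γ t)) (deviation γ Γ t) = c := by
  -- Defined through a chart depending on `t`; by uniqueness of covariant derivatives the same
  -- formula holds in every chart (`hcY'`), which makes `Y'` differentiable.
  let Y' : ∀ t, TangentSpace 𝓘(ℝ, E) (γ t) := fun t ↦ (coordVec (chartAt E (γ t)) (γ t)).inverse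
    (covPartial (g.inChart (chartAt E (γ t))) (coordFamily (chartAt E (γ t)) Γ) (0, 1) (1, 0)
      (0, t))
  have hY' : ∀ t ∈ J, HasCovDerivAlong g γ (deviation γ Γ) t (Y' t) := fun t ht ↦
    h.hasCovDerivAlong_deviation hJ hγ (chartAt_mem_atlas _) ht (mem_chart_source E _)
  have hcY' : ∀ φ ∈ atlas E M, ∀ t ∈ J, γ t ∈ φ.source → coordVec φ (γ t) (Y' t) =
      covPartial (g.inChart φ) (coordFamily φ Γ) (0, 1) (1, 0) (0, t) := by
    intro φ hφ t ht hs
    rw [(hY' t ht).unique (h.hasCovDerivAlong_deviation hJ hγ hφ ht hs), coordVec_inverse hφ hs]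
  refine ⟨⟨Y', fun t ht ↦ ⟨hY' t ht, ?_⟩⟩, exists_eq_const_of_hasDerivAt_zero hJ hJc
    fun t ht ↦ ?_⟩
  · rw [HasCovDerivAlong.iff_chartAt]
    have hγt := hγ.mdifferentiableAt hJ ht
    refine ⟨hγt, ?_⟩
    rw [coordVec_riemann]
    have hev := HasCovDerivAlong.eventually_mem_source hγt
    have hφ := chartAt_mem_atlas (E := E) (γ t)
    have hs := mem_chart_source E (γ t)
    set φ := chartAt E (γ t)
    have hs' : Γ 0 t ∈ φ.source := by rwa [h.eq t ht]
    have hG := isMetricOn_inChart g hφ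
    have hc := h.contDiffAt hφ (h.mem t ht) hs'
    have hx : coordFamily φ Γ (0, t) ∈ φ.target := φ.map_source hs'
    have h2 : (fun s ↦ coordVec φ (γ s) (Y' s)) =ᶠ[𝓝 t]
        fun s ↦ covPartial (g.inChart φ) (coordFamily φ Γ) (0, 1) (1, 0) (0, s) := by
      filter_upwards [hJ.mem_nhds ht, hev] with s hsJ hss using hcY' φ hφ s hsJ hss
    have h3 : HasDerivAt (fun s ↦ covPartial (g.inChart φ) (coordFamily φ Γ) (0, 1) (1, 0) (0, s))
        (fderiv ℝ (covPartial (g.inChart φ) (coordFamily φ Γ) (0, 1) (1, 0)) (0, t) (0, 1)) t :=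
      HasFDerivAt.comp_hasDerivAt
        (l := covPartial (g.inChart φ) (coordFamily φ Γ) (0, 1) (1, 0)) t
        ((hG.contDiffAt_covPartial hx hc _ _).differentiableAt (by simp)).hasFDerivAt
        (hasDerivAt_line 0 t)
    refine (h3.congr_of_eventuallyEq h2).congr_deriv ?_
    have hgeo : ∀ᶠ p in 𝓝 ((0 : ℝ), t),
        covPartial (g.inChart φ) (coordFamily φ Γ) (0, 1) (0, 1) p = 0 := by
      filter_upwards [h.eventually (h.mem t ht) hs'] with p hp
        using h.covPartial_eq_zero hφ hp.1 hp.2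
    have h4 := hG.geodesic_deviation hx hc (a := (1, 0)) hgeo
    have h5 : coordFamily φ Γ (0, t) = φ (γ t) := by rw [coordFamily, h.eq t ht]
    rw [hcY' φ hφ t ht hs, hγ.velocity_eq hJ ht, h.coordVec_field hJ hγ hφ ht hs,
      h.coordVec_deviation hφ ht hs, ← h5, ← h4, add_sub_cancel_right]
  · refine ((hV.isParallelOn hnull hJ hγ t ht).inner (hY' t ht)).congr_deriv ?_
    have hφ := chartAt_mem_atlas (E := E) (γ t)
    have hs := mem_chart_source E (γ t)
    set φ := chartAt E (γ t)
    have hs' : Γ 0 t ∈ φ.source := by rwa [h.eq t ht]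
    have hG := isMetricOn_inChart g hφ
    have hc := h.contDiffAt hφ (h.mem t ht) hs'
    have hx : coordFamily φ Γ (0, t) ∈ φ.target := φ.map_source hs'
    have h5 : coordFamily φ Γ (0, t) = φ (γ t) := by rw [coordFamily, h.eq t ht]
    rw [map_zero, zero_apply, zero_add, g.symm, inner_eq_inChart g hφ hs, hcY' φ hφ t ht hs,
      h.coordVec_field hJ hγ hφ ht hs, hG.covPartial_comm hx hc, ← h5]
    have h6 := hG.fderiv_inner_partial hx hc (1, 0) (0, 1)
    let N : ℝ × ℝ → ℝ := fun p ↦ g.inChart φ (coordFamily φ Γ p)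
      (fderiv ℝ (coordFamily φ Γ) p (0, 1)) (fderiv ℝ (coordFamily φ Γ) p (0, 1))
    have hN : DifferentiableAt ℝ N (0, t) := by
      have hd := (contDiffAt_fderiv_apply hc (0, 1)).differentiableAt (by simp)
      exact (((hG.hasFDerivAt hx).differentiableAt.comp (0, t)
        (hc.differentiableAt (by simp))).clm_apply hd).clm_apply hd
    -- Causality gives N ≤ 0, with equality on the null curve γ. So the transverse derivative of N,
    -- which is 2 V·∇_V Y by vanishing torsion, is zero.
    have h7 : IsLocalMax N (0, t) := by
      have hN0 : N (0, t) = 0 := by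
        simp only [N]
        rw [← h.coordVec_field hJ hγ hφ ht hs, h5, ← inner_eq_inChart g hφ hs, (hnull _).2]
      filter_upwards [h.eventually (h.mem t ht) hs'] with p hp
      rw [hN0]
      have := h.causal p hp.1
      rwa [inner_eq_inChart g hφ hp.2, h.coordVec_velocity hφ hp.1 hp.2] at this
    have h8 : fderiv ℝ N (0, t) (1, 0) = 0 := by rw [h7.fderiv_eq_zero, zero_apply]
    have h9 := h6.symm.trans h8
    linarith

/-- The curve l ↦ (l, a(l)t) has tangent (1, a't) at l = 0, and the t-derivative of the family there
is V. -/
theorem deviation_reparam (ht : t ∈ J) {a : ℝ → ℝ} {a' : ℝ} (ha : a 0 = 1)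
    (ha' : HasDerivAt a a' 0) :
    deviation γ (fun l t ↦ Γ l (a l * t)) t = deviation γ Γ t + (a' * t) • V (γ t) := by
  have hφ := chartAt_mem_atlas (E := E) (γ t)
  have hs := mem_chart_source E (γ t)
  apply coordVec_injective hφ hs
  rw [h.coordVec_deviation_reparam hφ ht hs ha ha', map_add, map_smul,
    h.coordVec_deviation hφ ht hs, h.coordVec_field hJ hγ hφ ht hs, ← map_smul, ← map_add]
  simp

end IsGeodesicFamilyOn

theorem IsKilling.isStablyTrapped (hV : IsKilling g V) (hnull : IsGloballyNull g V)
    (hJ : IsOpen J) (hJc : J.OrdConnected) (hγ : IsMIntegralCurveOn γ V J) {t₀ : ℝ} (ht₀ : t₀ ∈ J)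
    (hr : HasNondegenerateRotation g V (γ t₀)) : IsStablyTrapped g γ J := by
  intro Γ hΓ
  obtain ⟨U, hU⟩ := hΓ.exists_domain
  obtain ⟨⟨Y', hY⟩, hc⟩ := hU.exists_isJacobiFieldOn hJ hγ hV hnull hJc
  obtain ⟨b, hb⟩ := hV.exists_isBoundedAlong hnull hJ hJc hγ ht₀ hr hY hc
  -- Any smooth positive a with a(0) = 1 and a'(0) = -b would do.
  have hd : HasDerivAt (fun l : ℝ ↦ Real.exp (-b * l)) (-b) 0 := by
    simpa using ((hasDerivAt_id (0 : ℝ)).const_mul (-b)).exp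
  refine ⟨fun l ↦ Real.exp (-b * l), ?_, by simp, fun l ↦ Real.exp_pos _, fun P hP ↦ ?_⟩
  · exact Real.contDiff_exp.comp (contDiff_const.mul contDiff_id)
  · obtain ⟨C, hC⟩ := hb P hP
    refine ⟨C, fun t ht ↦ ?_⟩
    rw [hU.deviation_reparam hJ hγ ht (by simp) hd]
    have := hC t ht
    beta_reduce at this
    rwa [sub_eq_add_neg, ← neg_smul, ← neg_mul] at this

end Deviation

/-! ### Maximal integral curves and inextendible geodesics. -/

section MaximalCurve

variable {E : Type*} [NormedAddCommGroup E] [NormedSpace ℝ E] [FiniteDimensional ℝ E]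
  [CompleteSpace E]
  {M : Type*} [TopologicalSpace M] [ChartedSpace E M] [IsManifold 𝓘(ℝ, E) ∞ M]
  {g : LorentzMetric E M} {V : ∀ p : M, TangentSpace 𝓘(ℝ, E) p}
  {γ γ₁ σ : ℝ → M} {J : Set ℝ} {t β : ℝ} {p : M}

/-- V at two propositionally equal points lies in different tangent space types; this transports
derivative statements between curves that agree. -/
theorem smulRight_congr {p q : M} (h : p = q) :
    (show ℝ →L[ℝ] E from (1 : ℝ →L[ℝ] ℝ).smulRight (V p)) =
      (show ℝ →L[ℝ] E from (1 : ℝ →L[ℝ] ℝ).smulRight (V q)) := by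
  subst h
  rfl

theorem hasMFDerivAt_field_congr
    (h : HasMFDerivAt 𝓘(ℝ, ℝ) 𝓘(ℝ, E) γ t ((1 : ℝ →L[ℝ] ℝ).smulRight (V (γ t))))
    (heq : γ₁ =ᶠ[𝓝 t] γ) :
    HasMFDerivAt 𝓘(ℝ, ℝ) 𝓘(ℝ, E) γ₁ t ((1 : ℝ →L[ℝ] ℝ).smulRight (V (γ₁ t))) :=
  Eq.mpr (congrArg (HasMFDerivAt 𝓘(ℝ, ℝ) 𝓘(ℝ, E) γ₁ t)
    (smulRight_congr (E := E) heq.self_of_nhds))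
    (h.congr_of_eventuallyEq heq)

theorem hasMFDerivWithinAt_field_congr {s : Set ℝ}
    (h : HasMFDerivWithinAt 𝓘(ℝ, ℝ) 𝓘(ℝ, E) γ s t ((1 : ℝ →L[ℝ] ℝ).smulRight (V (γ t))))
    (heq : ∀ r ∈ s, γ₁ r = γ r) (ht : γ₁ t = γ t) :
    HasMFDerivWithinAt 𝓘(ℝ, ℝ) 𝓘(ℝ, E) γ₁ s t ((1 : ℝ →L[ℝ] ℝ).smulRight (V (γ₁ t))) :=
  Eq.mpr (congrArg (HasMFDerivWithinAt 𝓘(ℝ, ℝ) 𝓘(ℝ, E) γ₁ s t)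
    (smulRight_congr (E := E) ht))
    (h.congr_mono heq ht subset_rfl)

/-- The hull of 0 and `t` is widened by half the smaller radius. Bounded intervals suffice for
gluing even if `J` is unbounded. -/
theorem exists_Ioo_subset (hJ : IsOpen J) (hJc : J.OrdConnected) (h0 : 0 ∈ J) (ht : t ∈ J) :
    ∃ a b, 0 ∈ Ioo a b ∧ t ∈ Ioo a b ∧ Ioo a b ⊆ J := by
  obtain ⟨ε, hε, h1⟩ := Metric.isOpen_iff.1 hJ 0 h0
  obtain ⟨δ, hδ, h2⟩ := Metric.isOpen_iff.1 hJ t ht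
  rw [Real.ball_eq_Ioo] at h1 h2
  have hm := lt_min hε hδ
  have key : ∀ c, c = 0 ∨ c = t → c - min ε δ / 2 ∈ J ∧ c + min ε δ / 2 ∈ J := by
    rintro c (rfl | rfl)
    · exact ⟨h1 ⟨by linarith [min_le_left ε δ], by linarith [min_le_left ε δ]⟩,
        h1 ⟨by linarith [min_le_left ε δ], by linarith [min_le_left ε δ]⟩⟩
    · exact ⟨h2 ⟨by linarith [min_le_right ε δ], by linarith [min_le_right ε δ]⟩,
        h2 ⟨by linarith [min_le_right ε δ], by linarith [min_le_right ε δ]⟩⟩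
  refine ⟨min 0 t - min ε δ / 2, max 0 t + min ε δ / 2, ?_, ?_, ?_⟩
  · exact ⟨by linarith [min_le_left 0 t], by linarith [le_max_left 0 t]⟩
  · exact ⟨by linarith [min_le_right 0 t], by linarith [le_max_right 0 t]⟩
  · refine Ioo_subset_Icc_self.trans (hJc.out (key _ (min_choice 0 t)).1 (key _ ?_).2)
    exact max_choice 0 t

/-- Existence of maximal integral curves. -/
theorem IsSmoothField.exists_maximal_integralCurve [T2Space M] (hV : IsSmoothField V) (p : M) :
    ∃ (γ : ℝ → M) (J : Set ℝ), IsOpen J ∧ J.OrdConnected ∧ 0 ∈ J ∧ γ 0 = p ∧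
      IsMIntegralCurveOn γ V J ∧ ∀ (σ : ℝ → M) (J' : Set ℝ), IsOpen J' → J'.OrdConnected → 0 ∈ J' →
        σ 0 = p → IsMIntegralCurveOn σ V J' → J' ⊆ J := by
  have : IsManifold 𝓘(ℝ, E) 1 M := IsManifold.of_le (n := ∞) (by simp)
  have hV1 : ContMDiff 𝓘(ℝ, E) 𝓘(ℝ, E).tangent 1
      (fun p ↦ (⟨p, V p⟩ : TangentBundle 𝓘(ℝ, E) M)) := ContMDiff.of_le hV (by simp)
  -- Pairs of end points of intervals around 0 carrying an integral curve through `p`. The maximal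
  -- domain is their union, and by uniqueness, which uses the Hausdorff property, the curves glue.
  let S : Set (ℝ × ℝ) := {I | 0 ∈ Ioo I.1 I.2 ∧
    ∃ σ : ℝ → M, σ 0 = p ∧ IsMIntegralCurveOn σ V (Ioo I.1 I.2)}
  have : Nonempty M := ⟨p⟩
  choose! σ hσ0 hσ using fun (I : ℝ × ℝ) (hI : I ∈ S) ↦ hI.2
  let J : Set ℝ := ⋃ I ∈ S, Ioo I.1 I.2
  have hJmem : ∀ t ∈ J, ∃ I ∈ S, t ∈ Ioo I.1 I.2 := fun t ht ↦ by
    obtain ⟨A, hA, h⟩ := mem_iUnion₂.1 ht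
    exact ⟨A, hA, h⟩
  choose! I hIS htI using hJmem
  have huniq : ∀ A ∈ S, ∀ B ∈ S, ∀ t ∈ Ioo A.1 A.2, t ∈ Ioo B.1 B.2 → σ A t = σ B t := by
    intro A hA B hB t htA htB
    have h := isMIntegralCurveOn_Ioo_eqOn_of_contMDiff_boundaryless
      (a := max A.1 B.1) (b := min A.2 B.2) (t₀ := 0)
      ⟨max_lt hA.1.1 hB.1.1, lt_min hA.1.2 hB.1.2⟩ hV1
      ((hσ A hA).mono (Ioo_subset_Ioo (le_max_left _ _) (min_le_left _ _)))
      ((hσ B hB).mono (Ioo_subset_Ioo (le_max_right _ _) (min_le_right _ _)))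
      ((hσ0 A hA).trans (hσ0 B hB).symm)
    exact h ⟨max_lt htA.1 htB.1, lt_min htA.2 htB.2⟩
  have hsub : ∀ A ∈ S, Ioo A.1 A.2 ⊆ J := fun A hA ↦ 
    subset_biUnion_of_mem (u := fun A : ℝ × ℝ ↦ Ioo A.1 A.2) hA
  have hJo : IsOpen J := isOpen_biUnion fun A _ ↦ isOpen_Ioo
  obtain ⟨A₀, hA₀⟩ : S.Nonempty := by
    obtain ⟨σ, hσ0, hσ⟩ := exists_isMIntegralCurveAt_of_contMDiffAt_boundaryless (I := 𝓘(ℝ, E))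
      0 (hV1.contMDiffAt (x := p))
    obtain ⟨ε, hε, h⟩ := isMIntegralCurveAt_iff'.1 hσ
    rw [Real.ball_eq_Ioo] at h
    exact ⟨(0 - ε, 0 + ε), ⟨by simpa using hε, by simpa using hε⟩, σ, hσ0, h⟩
  have h0J : (0 : ℝ) ∈ J := hsub A₀ hA₀ hA₀.1
  refine ⟨fun t ↦ σ (I t) t, J, hJo, ?_, h0J, ?_, ?_, ?_⟩
  · refine IsPreconnected.ordConnected ?_
    exact isPreconnected_of_forall 0 fun t ht ↦
      ⟨_, hsub _ (hIS t ht), (hIS t ht).1, htI t ht, isPreconnected_Ioo⟩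
  · exact hσ0 _ (hIS 0 h0J)
  · intro t ht
    have hA := hIS t ht
    have h1 := (hσ _ hA).hasMFDerivAt_of_isOpen isOpen_Ioo (htI t ht)
    refine (hasMFDerivAt_field_congr h1 ?_).hasMFDerivWithinAt
    filter_upwards [isOpen_Ioo.mem_nhds (htI t ht)] with s hs
    exact huniq _ (hIS s (hsub _ hA hs)) _ hA s (htI s (hsub _ hA hs)) hs
  · intro σ' J' hJ' hJc' h0 hσ'0 hσ' t ht
    obtain ⟨a, b, h0', ht', hs⟩ := exists_Ioo_subset hJ' hJc' h0 ht
    exact hsub (a, b) ⟨h0', σ', hσ'0, hσ'.mono hs⟩ ht'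

/-- A geodesic which extends an integral curve of `V` to a boundary point of its interval of
definition has velocity `V` there. -/
theorem IsGeodesicOn.hasMFDerivAt_of_mem_closure (hV : IsSmoothField V) {J₁ : Set ℝ}
    (hgeo : IsGeodesicOn g γ₁ J₁) (hJ : IsOpen J) (hγ : IsMIntegralCurveOn γ₁ V J)
    (hβ₁ : β ∈ J₁) (hβ : β ∈ closure J) :
    HasMFDerivAt 𝓘(ℝ, ℝ) 𝓘(ℝ, E) γ₁ β ((1 : ℝ →L[ℝ] ℝ).smulRight (V (γ₁ β))) := by
  obtain ⟨hd, hv⟩ := HasCovDerivAlong.iff_chartAt.1 (hgeo β hβ₁)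
  have hev := HasCovDerivAlong.eventually_mem_source hd
  have hφ := chartAt_mem_atlas (E := E) (γ₁ β)
  have hs := mem_chart_source E (γ₁ β)
  set φ := chartAt E (γ₁ β)
  have h1 := hv.continuousAt
  have h2 : ContinuousAt (fun s ↦ fieldIn φ V (φ (γ₁ s))) β :=
    ContinuousAt.comp (f := fun s ↦ φ (γ₁ s)) (hV.contDiffAt_fieldIn hφ hs).continuousAt
      (hasDerivAt_chart_comp hφ hs hd).continuousAt
  have hne : (𝓝[J] β).NeBot := mem_closure_iff_nhdsWithin_neBot.1 hβ
  -- A geodesic has continuous velocity, so the equality with V on `J` passes to the limit `β`.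
  have h3 : (fun s ↦ coordVec φ (γ₁ s) (velocity γ₁ s)) =ᶠ[𝓝[J] β]
      fun s ↦ fieldIn φ V (φ (γ₁ s)) := by
    filter_upwards [self_mem_nhdsWithin, mem_nhdsWithin_of_mem_nhds hev] with s hsJ hss
    rw [fieldIn_apply hss, hγ.velocity_eq hJ hsJ]
  have h4 := tendsto_nhds_unique
    ((h1.tendsto.mono_left nhdsWithin_le_nhds).congr' h3)
    (h2.tendsto.mono_left nhdsWithin_le_nhds)
  rw [fieldIn_apply hs] at h4
  have h5 : velocity γ₁ β = V (γ₁ β) := coordVec_injective hφ hs h4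
  have h6 : mfderiv 𝓘(ℝ, ℝ) 𝓘(ℝ, E) γ₁ β = (1 : ℝ →L[ℝ] ℝ).smulRight (V (γ₁ β)) := by
    rw [← h5]
    ext
    exact (one_smul ℝ _).symm
  rw [← h6]
  exact hd.hasMFDerivAt

/-- An interval containing 0 has at most one missing end point on each side of 0, and `0 < t * β`
puts both on the same side. -/
theorem eq_of_mem_closure_of_notMem (hJc : J.OrdConnected) (h0 : 0 ∈ J) (ht : t ∈ closure J)
    (ht' : t ∉ J) (hβ : β ∈ closure J) (hβ' : β ∉ J) (hpos : 0 < t * β) : t = β := by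
  have h1 : ∀ x ∉ J, ∀ y ∈ closure J, ¬ (0 < x ∧ x < y) ∧ ¬ (x < 0 ∧ y < x) := by
    intro x hx y hy
    refine ⟨fun h ↦ ?_, fun h ↦ ?_⟩
    · obtain ⟨z, hz, hzJ⟩ := mem_closure_iff_nhds.1 hy _ (Ioi_mem_nhds h.2)
      exact hx (hJc.out h0 hzJ ⟨h.1.le, le_of_lt hz⟩)
    · obtain ⟨z, hz, hzJ⟩ := mem_closure_iff_nhds.1 hy _ (Iio_mem_nhds h.2)
      exact hx (hJc.out hzJ h0 ⟨le_of_lt hz, h.1.le⟩)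
  have h2 := h1 t ht' β hβ
  have h3 := h1 β hβ' t ht
  rcases pos_and_pos_or_neg_and_neg_of_mul_pos hpos with h | h <;>
  rcases lt_trichotomy t β with h4 | h4 | h4
  · exact absurd ⟨h.1, h4⟩ h2.1
  · exact h4
  · exact absurd ⟨h.2, h4⟩ h3.1
  · exact absurd ⟨h.2, h4⟩ h3.2
  · exact h4
  · exact absurd ⟨h.1, h4⟩ h2.2

/-- An integral curve can be continued over a boundary point of its interval of definition where it
has velocity `V`. -/
theorem IsSmoothField.exists_integralCurve_extension (hV : IsSmoothField V)
    (hJ : IsOpen J) (hJc : J.OrdConnected) (h0 : 0 ∈ J) (hγ : IsMIntegralCurveOn γ V J)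
    (hβ : β ∈ closure J) (hβ' : β ∉ J)
    (hd : HasMFDerivAt 𝓘(ℝ, ℝ) 𝓘(ℝ, E) γ β ((1 : ℝ →L[ℝ] ℝ).smulRight (V (γ β)))) :
    ∃ (σ : ℝ → M) (J' : Set ℝ), IsOpen J' ∧ J'.OrdConnected ∧ 0 ∈ J' ∧ β ∈ J' ∧ σ 0 = γ 0 ∧
      IsMIntegralCurveOn σ V J' := by
  classical
  have : IsManifold 𝓘(ℝ, E) 1 M := IsManifold.of_le (n := ∞) (by simp)
  have hV1 : ContMDiff 𝓘(ℝ, E) 𝓘(ℝ, E).tangent 1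
      (fun p ↦ (⟨p, V p⟩ : TangentBundle 𝓘(ℝ, E) M)) := ContMDiff.of_le hV (by simp)
  have hβ0 : β ≠ 0 := fun h ↦ hβ' (h ▸ h0)
  obtain ⟨σ, hσβ, hσ⟩ := exists_isMIntegralCurveAt_of_contMDiffAt_boundaryless (I := 𝓘(ℝ, E))
    β (hV1.contMDiffAt (x := γ β))
  obtain ⟨ε₀, hε₀, hσ⟩ := isMIntegralCurveAt_iff'.1 hσ
  -- The bound by |β| keeps the ball on one side of 0, so that it contains no boundary point of `J`
  -- other than `β`.
  obtain ⟨ε, hε, hε1, hε2⟩ : ∃ ε > 0, ε ≤ ε₀ ∧ ε ≤ |β| :=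
    ⟨min ε₀ |β|, lt_min hε₀ (abs_pos.2 hβ0), min_le_left _ _, min_le_right _ _⟩
  replace hσ := hσ.mono (Metric.ball_subset_ball hε1)
  have hball : ∀ t ∈ Metric.ball β ε, 0 < t * β := by
    intro t ht
    rw [Metric.mem_ball, Real.dist_eq] at ht
    have h1 := abs_lt.1 (ht.trans_le hε2)
    rcases lt_or_gt_of_ne hβ0 with h | h
    · rw [abs_of_neg h] at h1
      exact mul_pos_of_neg_of_neg (by linarith) h
    · rw [abs_of_pos h] at h1
      exact mul_pos (by linarith) h
  obtain ⟨f, hfJ, hfJc⟩ : ∃ f : ℝ → M, (∀ t ∈ J, f t = γ t) ∧ ∀ t ∉ J, f t = σ t :=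
    ⟨fun t ↦ if t ∈ J then γ t else σ t, fun t ht ↦ if_pos ht, fun t ht ↦ if_neg ht⟩
  refine ⟨f, J ∪ Metric.ball β ε, hJ.union Metric.isOpen_ball,
    ?_, Or.inl h0, Or.inr (Metric.mem_ball_self hε), hfJ 0 h0, ?_⟩
  · refine IsPreconnected.ordConnected (IsPreconnected.union' ?_
      (isPreconnected_iff_ordConnected.2 hJc) ?_)
    · obtain ⟨z, hz, hzJ⟩ := mem_closure_iff_nhds.1 hβ _ (Metric.ball_mem_nhds β hε)
      exact ⟨z, hzJ, hz⟩
    · rw [Real.ball_eq_Ioo]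
      exact isPreconnected_Ioo
  · intro t ht
    refine HasMFDerivAt.hasMFDerivWithinAt ?_
    by_cases htJ : t ∈ J
    · refine hasMFDerivAt_field_congr (hγ.hasMFDerivAt_of_isOpen hJ htJ) ?_
      filter_upwards [hJ.mem_nhds htJ] with s hs using hfJ s hs
    · have htb : t ∈ Metric.ball β ε := ht.resolve_left htJ
      have hσt := hσ.hasMFDerivAt_of_isOpen Metric.isOpen_ball htb
      by_cases hcl : t ∈ closure J
      · obtain rfl := eq_of_mem_closure_of_notMem hJc h0 hcl htJ hβ hβ' (hball t htb)
        -- At the junction the glued curve follows γ on `J` and σ on its complement; both have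
        -- derivative V there, and the one-sided derivatives combine.
        have hu := HasMFDerivWithinAt.union
          (hasMFDerivWithinAt_field_congr hd.hasMFDerivWithinAt hfJ ((hfJc t htJ).trans hσβ))
          (hasMFDerivWithinAt_field_congr (s := Jᶜ) hσt.hasMFDerivWithinAt hfJc (hfJc t htJ))
        rw [union_compl_self] at hu
        exact hasMFDerivWithinAt_univ.1 hu
      · refine hasMFDerivAt_field_congr hσt ?_
        filter_upwards [isClosed_closure.isOpen_compl.mem_nhds hcl] with s hs
        exact hfJc s fun h ↦ hs (subset_closure h)

/-- Through every point passes an integral curve of the null Killing field which is inextendible as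
a geodesic. -/
theorem IsKilling.exists_inextendible [T2Space M] (hV : IsKilling g V)
    (hnull : IsGloballyNull g V) (p : M) :
    ∃ (γ : ℝ → M) (J : Set ℝ), IsOpen J ∧ J.OrdConnected ∧ 0 ∈ J ∧ γ 0 = p ∧
      IsMIntegralCurveOn γ V J ∧ IsInextendibleGeodesic g γ J := by
  obtain ⟨γ, J, hJ, hJc, h0, hp, hγ, hmax⟩ := hV.smooth.exists_maximal_integralCurve p
  refine ⟨γ, J, hJ, hJc, h0, hp, hγ, (hV.isNullGeodesicOn hnull hJ hγ).1, ?_⟩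
  intro γ₁ J₁ hJ₁ hJc₁ hJJ₁ hgeo heq
  have hγ₁ : IsMIntegralCurveOn γ₁ V J := fun t ht ↦
    (hasMFDerivAt_field_congr (hγ.hasMFDerivAt_of_isOpen hJ ht) (by
      filter_upwards [hJ.mem_nhds ht] with s hs using heq hs)).hasMFDerivWithinAt
  refine (Subset.antisymm hJJ₁ ?_).symm
  -- It remains to see that `J` is closed in `J₁`: a missing boundary point in `J₁` would allow a
  -- continuation of the integral curve, against maximality.
  refine (isPreconnected_iff_ordConnected.2 hJc₁).subset_of_closure_inter_subset hJ
    ⟨0, hJJ₁ h0, h0⟩ ?_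
  rintro β ⟨hβ, hβ₁⟩
  by_contra hβ'
  obtain ⟨σ, J', hJ', hJc', h0', hβJ', hσ0, hσ⟩ :=
    hV.smooth.exists_integralCurve_extension hJ hJc h0 hγ₁ hβ hβ'
      (hgeo.hasMFDerivAt_of_mem_closure hV.smooth hJ hγ₁ hβ₁ hβ)
  exact hβ' (hmax σ J' hJ' hJc' h0' (by rw [hσ0, heq h0, hp]) hσ hβJ')

end MaximalCurve

end NullKilling

/-- The dimension is d = n + 2; the assertion about d = 6 is the last conjunct for n = 4, applied at
every point. -/
theorem mainTheorem3 {n : ℕ} {M : Type*} [TopologicalSpace M] [T2Space M]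
    [ChartedSpace (EuclideanSpace ℝ (Fin (n + 2))) M] [IsManifold (𝓡 (n + 2)) ∞ M]
    (g : NullKilling.LorentzMetric (EuclideanSpace ℝ (Fin (n + 2))) M)
    (V : ∀ p : M, TangentSpace (𝓡 (n + 2)) p)
    (hV : NullKilling.IsKilling g V) (hnull : NullKilling.IsGloballyNull g V) :
    -- every integral curve `γ` of `V`, on an open interval `J`
    (∀ (γ : ℝ → M) (J : Set ℝ), IsOpen J → J.OrdConnected → IsMIntegralCurveOn γ V J →
      NullKilling.IsNullGeodesicOn g γ J ∧
      -- deviation vectors of families of causal geodesics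
      (∀ Γ : ℝ → ℝ → M, NullKilling.IsCausalGeodesicFamily g γ J Γ →
        (∃ Y' : ∀ t, TangentSpace (𝓡 (n + 2)) (γ t),
          NullKilling.IsJacobiFieldOn g γ J (NullKilling.deviation γ Γ) Y') ∧
        ∃ c : ℝ, ∀ t ∈ J, g.inner (γ t) (V (γ t)) (NullKilling.deviation γ Γ t) = c) ∧
      -- Jacobi fields
      (∀ Y Y' : ∀ t, TangentSpace (𝓡 (n + 2)) (γ t), NullKilling.IsJacobiFieldOn g γ J Y Y' →
        (∃ C' : ℝ, ∀ t ∈ J,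
          g.inner (γ t) (Y' t) (Y' t) + NullKilling.rotationSq g V (γ t) (Y t) = C') ∧
        ((∃ c : ℝ, ∀ t ∈ J, g.inner (γ t) (V (γ t)) (Y t) = c) →
          (∃ C'' : ℝ, ∀ t ∈ J, 0 ≤ NullKilling.rotationSq g V (γ t) (Y t) ∧
            NullKilling.rotationSq g V (γ t) (Y t) ≤ C'') ∧
          -- `ω_{ij} Y^j` is bounded
          (∀ (k : ∀ t, TangentSpace (𝓡 (n + 2)) (γ t))
            (e : Fin n → ∀ t, TangentSpace (𝓡 (n + 2)) (γ t)),
            NullKilling.IsParallelNullFrame g V γ J k e →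
            ∃ C : ℝ, ∀ t ∈ J, ∀ i, |∑ j, NullKilling.rotation g V (γ t) (e i t) (e j t) *
              g.inner (γ t) (e j t) (Y t)| ≤ C) ∧
          -- `n · Y` is bounded on the ergosurface `Z · V = 0`, where `n = ∇(Z · V)`
          (∀ Z : ∀ p : M, TangentSpace (𝓡 (n + 2)) p, NullKilling.IsKilling g Z →
            (∀ p, VectorField.mlieBracket (𝓡 (n + 2)) V Z p = 0) →
            (∃ t₀ ∈ J, g.inner (γ t₀) (Z (γ t₀)) (V (γ t₀)) = 0) →
            (∀ t ∈ J, g.inner (γ t) (Z (γ t)) (V (γ t)) = 0) ∧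
            ∃ C : ℝ, ∀ t ∈ J,
              |mvfderiv (𝓡 (n + 2)) (fun p ↦ g.inner p (Z p) (V p)) (γ t) (Y t)| ≤ C) ∧
          -- non-degenerate rotation: bounded up to a linear multiple of `V`
          ((∃ t₀ ∈ J, NullKilling.HasNondegenerateRotation g V (γ t₀)) →
            ∃ b : ℝ, NullKilling.IsBoundedAlong g γ J (fun t ↦ Y t - (b * t) • V (γ t))))) ∧
      ((∃ t₀ ∈ J, NullKilling.HasNondegenerateRotation g V (γ t₀)) →
        NullKilling.IsStablyTrapped g γ J)) ∧
    -- a stably trapped inextendible null geodesic with tangent `V` through every such point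
    (∀ p : M, NullKilling.HasNondegenerateRotation g V p →
      ∃ (γ : ℝ → M) (J : Set ℝ), IsOpen J ∧ J.OrdConnected ∧ 0 ∈ J ∧ γ 0 = p ∧
        IsMIntegralCurveOn γ V J ∧ NullKilling.IsNullGeodesicOn g γ J ∧
        NullKilling.IsInextendibleGeodesic g γ J ∧ NullKilling.IsStablyTrapped g γ J) := by
  have hn : Module.finrank ℝ (EuclideanSpace ℝ (Fin (n + 2))) = n + 2 := by simp
  refine ⟨fun γ J hJ hJc hγ ↦ ⟨hV.isNullGeodesicOn hnull hJ hγ, fun Γ hΓ ↦ ?_,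
    fun Y Y' hY ↦ ⟨hV.exists_jacobi_energy_eq hnull hJ hJc hγ hY, fun hc ↦
      ⟨hV.exists_rotationSq_le hnull hJ hJc hγ hY hc,
        fun k e hF ↦ hV.exists_rotation_sum_le hnull hJ hJc hγ hn hY hc hF,
        fun Z hZ hVZ h0 ↦ hV.ergosurface hnull hJ hJc hγ hZ hVZ h0 hY hc, ?_⟩⟩, ?_⟩, ?_⟩
  · obtain ⟨U, hU⟩ := hΓ.exists_domain
    exact hU.exists_isJacobiFieldOn hJ hγ hV hnull hJc
  · rintro ⟨t₀, ht₀, hr⟩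
    exact hV.exists_isBoundedAlong hnull hJ hJc hγ ht₀ hr hY hc
  · rintro ⟨t₀, ht₀, hr⟩
    exact hV.isStablyTrapped hnull hJ hJc hγ ht₀ hr
  · intro p hr
    obtain ⟨γ, J, hJ, hJc, h0, rfl, hγ, hinext⟩ := hV.exists_inextendible hnull p
    exact ⟨γ, J, hJ, hJc, h0, rfl, hγ, hV.isNullGeodesicOn hnull hJ hγ, hinext,
      hV.isStablyTrapped hnull hJ hJc hγ h0 hr⟩
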